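/- A $k$-player game consists of finite query sets $\mathcal X_1,\dots,\mathcal X_k$, finite answer sets $\mathcal Y_1,\dots,\mathcal Y_k$, a probability distribution $\mathcal Q$ on $\mathcal X_1\times\dots\times\mathcal X_k$, and a winning predicate $W(x,y)$ on queries and answers. Its value $\mathrm{val}(\mathcal G)$ is the maximum, over all functions $f_i:\mathcal X_i\to\mathcal Y_i$ ($1\le i\le k$), of $\Pr_{x\sim\mathcal Q}[W(x,(f_1(x_1),\dots,f_k(x_k)))]$. In its $n$-fold parallel repetition $\mathcal G^n$, $n$ query tuples $x^1,\dots,x^n$ are drawn independently from $\mathcal Q$, player $i$ receives $(x_i^1,\dots,x_i^n)$ and answers with $(y_i^1,\dots,y_i^n)\in\mathcal Y_i^n$, and the players win if $W(x^j,y^j)$ holds for every $j\in\{1,\dots,n\}$. Let $\mathcal Q$ be the uniform distribution on $\{x\in\mathbb F_2^3 : x_1+x_2+x_3=0\}$. The GHZ game is the three-player game with query distribution $\mathcal Q$, answer sets $\mathbb F_2$, and winning condition $y_1+y_2+y_3 = x_1\lor x_2\lor x_3 \pmod 2$. **Theorem.** 1. There is a constant $c>0$ such that $\mathrm{val}(\mathrm{GHZ}^n)\le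 n^{-c}$ for every integer $n\ge 1$. 2. For every $K\in\mathbb N$ there is a constant $c>0$, depending only on $K$, such that for every three-player game $\mathcal G$ with query distribution $\mathcal Q$, answer sets $\mathcal Y_1,\mathcal Y_2,\mathcal Y_3$ of size at most $K$, and any winning predicate with $\mathrm{val}(\mathcal G)<1$, we have $\mathrm{val}(\mathcal G^n)\le n^{-c}$ for every integer $n\ge 1$. -/

import Mathlib

/-- A `k`-player game: player `i` receives a query in the finite set `X i` and answers in `Y i`.
`query` is the query distribution, a probability mass function on the product of the `X i`,
and `W x y` says that the answers `y` win on the queries `x`. -/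
structure MultiplayerGame {k : ℕ} (X Y : Fin k → Type*) [∀ i, Fintype (X i)] where
  query : (∀ i, X i) → ℝ
  query_nonneg : ∀ x, 0 ≤ query x
  query_sum : ∑ x, query x = 1
  W : (∀ i, X i) → (∀ i, Y i) → Prop

namespace MultiplayerGame

/-- A deterministic strategy: the answer of player `i` is a function of the query to player `i`
only. -/
abbrev Strategy {k : ℕ} (X Y : Fin k → Type*) := ∀ i, X i → Y i

open Classical in
/-- The probability, over the query distribution, that the strategy `f` wins. -/
noncomputable def success {k : ℕ} {X Y : Fin k → Type*} [∀ i, Fintype (X i)]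
    (G : MultiplayerGame X Y) (f : Strategy X Y) : ℝ :=
  ∑ x, if G.W x (fun i => f i (x i)) then G.query x else 0

/-- The value of a game: the maximum success probability of a deterministic strategy
(see `isGreatest_value`; it is `0` in the degenerate case that there is no strategy at all). -/
noncomputable def value {k : ℕ} {X Y : Fin k → Type*} [∀ i, Fintype (X i)]
    (G : MultiplayerGame X Y) : ℝ :=
  ⨆ f : Strategy X Y, G.success f

/-- The value is an attained maximum when the answer sets are finite and non-empty. -/
theorem isGreatest_value {k : ℕ} {X Y : Fin k → Type*} [∀ i, Fintype (X i)]
    [∀ i, Finite (Y i)] [∀ i, Nonempty (Y i)] (G : MultiplayerGame X Y) :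
    IsGreatest (Set.range G.success) G.value := by
  have hne : (Set.range G.success).Nonempty := Set.range_nonempty _
  have hfin : (Set.range G.success).Finite := Set.finite_range _
  exact ⟨hne.csSup_mem hfin, fun _ ha => le_csSup hfin.bddAbove ha⟩

/-- The `n`-fold parallel repetition: `n` independent query tuples are drawn, player `i` receives
its `n` queries and produces `n` answers, and the players win if they win in every coordinate.
Here `x i j` is the query to player `i` in coordinate `j`. -/
noncomputable def repetition {k : ℕ} {X Y : Fin k → Type*} [∀ i, Fintype (X i)]
    (G : MultiplayerGame X Y) (n : ℕ) :
    MultiplayerGame (fun i => Fin n → X i) (fun i => Fin n → Y i) where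
  query x := ∏ j, G.query (fun i => x i j)
  query_nonneg x := Finset.prod_nonneg fun _ _ => G.query_nonneg _
  query_sum := by
    classical
    have h := Equiv.sum_comp (Equiv.piComm (fun (i : Fin k) (_ : Fin n) => X i))
      (fun z => ∏ j, G.query (z j))
    refine h.trans ?_
    rw [← Fintype.prod_sum (fun (_ : Fin n) (z : ∀ i, X i) => G.query z)]
    simp [G.query_sum]
  W x y := ∀ j, G.W (fun i => x i j) (fun i => y i j)

/-- The three-player game with the GHZ query distribution, the uniform distribution on the
`x ∈ 𝔽₂³` with `x 0 + x 1 + x 2 = 0`, and with an arbitrary winning predicate `W`. -/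
noncomputable def ofGHZQueries {Y : Fin 3 → Type*}
    (W : (Fin 3 → ZMod 2) → (∀ i, Y i) → Prop) :
    MultiplayerGame (fun _ : Fin 3 => ZMod 2) Y where
  query x := if x 0 + x 1 + x 2 = 0 then 1 / 4 else 0
  query_nonneg x := by split_ifs <;> norm_num
  query_sum := by
    have h : (Finset.univ.filter
        (fun x : Fin 3 → ZMod 2 => x 0 + x 1 + x 2 = 0)).card = 4 := by decide
    rw [← Finset.sum_filter, Finset.sum_const, h]
    norm_num
  W := W

/-- The GHZ game: the players win if the sum modulo `2` of their answers is the logical OR of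
their queries. -/
noncomputable def GHZ : MultiplayerGame (fun _ : Fin 3 => ZMod 2) (fun _ : Fin 3 => ZMod 2) :=
  ofGHZQueries fun x y => y 0 + y 1 + y 2 = 1 ↔ (x 0 = 1 ∨ x 1 = 1 ∨ x 2 = 1)

end MultiplayerGame

/-!
A strategy for the `n`-fold game assigns to each pair `(x, y)` of queries in `V = 𝔽₂ⁿ` to the first
two players, which determines the third query `x + y`, the set of coordinates it loses. The
geometric fact behind the proof concerns *squares*
`(x, y), (x + d, y), (x, y + d), (x + d, y + d)`. Each player sees only two different queries on
a square, and if `d j = 1` then these differ in coordinate `j`, so that the four corners show in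
coordinate `j` all four admissible query triples of the one-round game. A strategy that wins
coordinate `j` at all corners would thus win the one-round game with certainty. Hence, if the value
is less than `1`, every square with `d j = 1` has a corner that loses `j` (`hitsSquares_loses`).

Let `A` be a product event: `x ∈ E₀`, `y ∈ E₁`, `x + y ∈ E₂`. If the three sets have small nontrivial
Fourier coefficients, a second moment computation shows that almost every pair of `A` is a corner
of about the same number of squares inside `A` with `d j = 1`
(`expect_squareWeight_sub_sq_le`). Each of these squares has a losing corner, so a constant
proportion of `A` loses coordinate `j` (`triAvg_ge_of_isUniform`). This works on any subspace of
`𝔽₂ⁿ` on which the coordinate `j` is not constant. If one of the sets has a large Fourier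
coefficient, splitting along the corresponding hyperplane raises the mean square density. After
a number of splittings polynomial in the inverse density of `A`, most pieces are uniform, and as
long as the codimension is at most `n / 4`, most coordinates remain nonconstant on every piece
(`sum_triAvg_ge`). So as long as `A` has density at least a small negative power of `n`, some
coordinate is lost on a fixed proportion of `A` (`exists_triAvg_ge`).

Finally, conditioning on the queries and answers in that coordinate splits `A` into a bounded
number `B` of product events, and the argument repeats within each. After `k` rounds the winning
probability is at most `(15 / 16) ^ k + B ^ k * α`, with `α` the least density allowed
(`card_win_le`), and taking `k` of order `log n` makes this a negative power of `n`. Only `B`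
depends on the game, through the bound on the sizes of the answer sets, which gives the uniformity.
-/

open Finset
open scoped BigOperators

/-! ### Fourier analysis on finite vector spaces over `𝔽₂` -/

namespace BinaryFourier

lemma expect_shift {V : Type*} [AddCommGroup V] [Fintype V] (f : V → ℝ) (a : V) :
    𝔼 x, f (x + a) = 𝔼 x, f x :=
  Fintype.expect_equiv (Equiv.addRight a) _ _ fun _ => rfl

lemma expect_shift_left {V : Type*} [AddCommGroup V] [Fintype V] (f : V → ℝ) (a : V) :
    𝔼 x, f (a + x) = 𝔼 x, f x :=
  Fintype.expect_equiv (Equiv.addLeft a) _ _ fun _ => rfl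

lemma expect_mono {ι : Type*} [Fintype ι] {f g : ι → ℝ} (h : ∀ x, f x ≤ g x) :
    𝔼 x, f x ≤ 𝔼 x, g x :=
  expect_le_expect fun x _ => h x

lemma expect_le_of_le {ι : Type*} [Fintype ι] [Nonempty ι] {f : ι → ℝ} {c : ℝ}
    (h : ∀ x, f x ≤ c) : 𝔼 x, f x ≤ c :=
  expect_le univ_nonempty fun x _ => h x

lemma le_expect_of_le {ι : Type*} [Fintype ι] [Nonempty ι] {f : ι → ℝ} {c : ℝ}
    (h : ∀ x, c ≤ f x) : c ≤ 𝔼 x, f x :=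
  le_expect univ_nonempty fun x _ => h x

lemma sq_expect_le {ι : Type*} [Fintype ι] [Nonempty ι] (f : ι → ℝ) :
    (𝔼 x, f x) ^ 2 ≤ 𝔼 x, f x ^ 2 := by
  have h := expect_mul_sq_le_sq_mul_sq (univ : Finset ι) f (fun _ => 1)
  simpa using h

/-- The nontrivial real character of `𝔽₂`, that is `a ↦ (-1) ^ a`. -/
noncomputable def sgn (a : ZMod 2) : ℝ := if a = 0 then 1 else -1

@[simp] lemma sgn_zero : sgn 0 = 1 := by simp [sgn]

@[simp] lemma sgn_one : sgn 1 = -1 := by simp [sgn]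

lemma zmod_two_cases (a : ZMod 2) : a = 0 ∨ a = 1 := by
  revert a; decide

lemma sgn_add (a b : ZMod 2) : sgn (a + b) = sgn a * sgn b := by
  have h : (1 : ZMod 2) + 1 = 0 := by decide
  rcases zmod_two_cases a with rfl | rfl <;> rcases zmod_two_cases b with rfl | rfl <;> simp [h]

lemma sgn_mul_self (a : ZMod 2) : sgn a * sgn a = 1 := by
  rcases zmod_two_cases a with rfl | rfl <;> simp

lemma abs_sgn (a : ZMod 2) : |sgn a| = 1 := by
  rcases zmod_two_cases a with rfl | rfl <;> simp

variable {V : Type*} [AddCommGroup V] [Module (ZMod 2) V]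

lemma add_self_eq_zero (v : V) : v + v = 0 := by
  have h : (2 : ZMod 2) = 0 := by decide
  rw [← two_smul (ZMod 2), h, zero_smul]

lemma add_add_cancel_self (x y : V) : x + (x + y) = y := by
  rw [← add_assoc, add_self_eq_zero, zero_add]

variable [Fintype V]

/-- The Fourier coefficient of `f` at the character `x ↦ (-1) ^ ℓ x`. -/
noncomputable def fourier (f : V → ℝ) (l : Module.Dual (ZMod 2) V) : ℝ := 𝔼 x, f x * sgn (l x)

lemma sum_sgn_dual [Fintype (Module.Dual (ZMod 2) V)] [DecidableEq V] (v : V) :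
    ∑ l : Module.Dual (ZMod 2) V, sgn (l v) = if v = 0 then (Fintype.card V : ℝ) else 0 := by
  split_ifs with h
  · have h1 : Fintype.card (Module.Dual (ZMod 2) V) = Fintype.card V := by
      rw [Module.card_eq_pow_finrank (K := ZMod 2),
        Module.card_eq_pow_finrank (K := ZMod 2) (V := V), Subspace.dual_finrank_eq]
    simp [h, h1]
  · obtain ⟨l₀, hl₀⟩ := Module.Projective.exists_dual_eq_one (ZMod 2) h
    have h1 : ∑ l : Module.Dual (ZMod 2) V, sgn (l v)
        = ∑ l : Module.Dual (ZMod 2) V, sgn ((l + l₀) v) :=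
      (Fintype.sum_equiv (Equiv.addRight l₀) _ _ fun _ => rfl).symm
    simp only [LinearMap.add_apply, sgn_add, hl₀, sgn_one, mul_neg, mul_one, sum_neg_distrib] at h1
    linarith

lemma parseval [Fintype (Module.Dual (ZMod 2) V)] (f : V → ℝ) :
    ∑ l : Module.Dual (ZMod 2) V, fourier f l ^ 2 = 𝔼 x, f x ^ 2 := by
  classical
  have h1 : ∀ l : Module.Dual (ZMod 2) V,
      fourier f l ^ 2 = 𝔼 x, 𝔼 y, f x * f y * sgn (l (x + y)) := by
    intro l
    rw [sq, fourier, Finset.expect_mul_expect]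
    refine expect_congr rfl fun x _ => expect_congr rfl fun y _ => ?_
    rw [map_add, sgn_add]; ring
  simp_rw [h1]
  rw [← expect_sum_comm]
  refine expect_congr rfl fun x _ => ?_
  rw [← expect_sum_comm]
  simp_rw [← mul_sum, sum_sgn_dual]
  rw [Fintype.expect_eq_sum_div_card, Finset.sum_eq_single x]
  · rw [if_pos (add_self_eq_zero x)]
    have : (Fintype.card V : ℝ) ≠ 0 := by exact_mod_cast Fintype.card_ne_zero
    field_simp
  · intro y _ hy
    rw [if_neg, mul_zero]
    intro h0
    apply hy
    have := add_add_cancel_self x y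
    rw [h0, add_zero] at this
    exact this.symm
  · simp

/-- The autocorrelation of `g`. -/
noncomputable def autocorr (g : V → ℝ) (w : V) : ℝ := 𝔼 s, g s * g (s + w)

lemma fourier_autocorr (g : V → ℝ) (l : Module.Dual (ZMod 2) V) :
    fourier (autocorr g) l = fourier g l ^ 2 := by
  have h1 : ∀ s : V, 𝔼 w, g s * g (s + w) * sgn (l w) = 𝔼 w, g s * g w * sgn (l (s + w)) := by
    intro s
    rw [← expect_shift_left (fun w => g s * g w * sgn (l (s + w))) s]
    simp_rw [add_add_cancel_self]
  simp only [fourier, autocorr, expect_mul]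
  rw [expect_comm]
  simp_rw [h1]
  rw [sq, Finset.expect_mul_expect]
  refine expect_congr rfl fun x _ => expect_congr rfl fun y _ => ?_
  rw [map_add, sgn_add]; ring

/-- A bounded function whose Fourier coefficients are all small has small autocorrelation on
average: this is the bound of the fourth moment of the Fourier transform by its maximum. -/
lemma expect_abs_autocorr_le {g : V → ℝ} {δ : ℝ} (hδ : 0 ≤ δ) (hg : ∀ x, |g x| ≤ 1)
    (h : ∀ l, |fourier g l| ≤ δ) : 𝔼 w, |autocorr g w| ≤ δ := by
  classical
  have : Finite (Module.Dual (ZMod 2) V) := DFunLike.finite _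
  let := Fintype.ofFinite (Module.Dual (ZMod 2) V)
  have h1 : 𝔼 w, autocorr g w ^ 2 ≤ δ ^ 2 := by
    rw [← parseval]
    simp_rw [fourier_autocorr]
    calc ∑ l, (fourier g l ^ 2) ^ 2 ≤ ∑ l, δ ^ 2 * fourier g l ^ 2 := by
          refine sum_le_sum fun l _ => ?_
          rw [sq (fourier g l ^ 2)]
          exact mul_le_mul_of_nonneg_right (sq_le_sq' (abs_le.1 (h l)).1 (abs_le.1 (h l)).2)
            (sq_nonneg _)
      _ = δ ^ 2 * 𝔼 x, g x ^ 2 := by rw [← mul_sum, parseval]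
      _ ≤ δ ^ 2 * 1 := by
          refine mul_le_mul_of_nonneg_left (expect_le_of_le fun x => ?_) (sq_nonneg _)
          exact (sq_le_one_iff_abs_le_one _).2 (hg x)
      _ = δ ^ 2 := mul_one _
  have h2 := sq_expect_le fun w => |autocorr g w|
  simp only [sq_abs] at h2
  exact abs_le_of_sq_le_sq' (h2.trans h1) hδ |>.2

/-- The average over `u` of `f u * g (u + s) * h (u + t)`. -/
noncomputable def corr (f g h : V → ℝ) (s t : V) : ℝ := 𝔼 u, f u * g (u + s) * h (u + t)

lemma abs_autocorr_le_one {V : Type*} [AddCommGroup V] [Fintype V] {g : V → ℝ}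
    (hg : ∀ x, |g x| ≤ 1) (w : V) : |autocorr g w| ≤ 1 := by
  refine (abs_expect_le _ _).trans (expect_le_of_le fun x => ?_)
  rw [abs_mul]
  exact mul_le_one₀ (hg _) (abs_nonneg _) (hg _)

/-- If one of the factors, here `g`, has small Fourier coefficients, then `corr f g h` is small in
mean square. -/
lemma expect_corr_sq_le {f g h : V → ℝ} {δ : ℝ} (hδ : 0 ≤ δ) (hf : ∀ x, |f x| ≤ 1)
    (hg : ∀ x, |g x| ≤ 1) (hh : ∀ x, |h x| ≤ 1) (hF : ∀ l, |fourier g l| ≤ δ) :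
    𝔼 s, 𝔼 t, corr f g h s t ^ 2 ≤ δ := by
  have hR : ∀ (k : V → ℝ) (u v : V), 𝔼 s, k (u + s) * k (v + s) = autocorr k (u + v) := by
    intro k u v
    rw [autocorr, ← expect_shift_left (fun s => k s * k (s + (u + v))) u]
    refine expect_congr rfl fun s _ => ?_
    congr 2
    rw [show u + s + (u + v) = u + (u + (v + s)) by abel, add_add_cancel_self]
  have h1 : 𝔼 s, 𝔼 t, corr f g h s t ^ 2
      = 𝔼 u, 𝔼 v, f u * f v * autocorr g (u + v) * autocorr h (u + v) := by
    have h2 : ∀ s t, corr f g h s t ^ 2 = 𝔼 u, 𝔼 v, f u * f v * (g (u + s) * g (v + s))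
        * (h (u + t) * h (v + t)) := by
      intro s t
      rw [sq, corr, Finset.expect_mul_expect]
      refine expect_congr rfl fun u _ => expect_congr rfl fun v _ => ?_
      ring
    simp_rw [h2]
    calc _ = 𝔼 s, 𝔼 u, 𝔼 v, 𝔼 t, f u * f v * (g (u + s) * g (v + s))
        * (h (u + t) * h (v + t)) := by
          refine expect_congr rfl fun s _ => ?_
          rw [expect_comm]
          exact expect_congr rfl fun u _ => expect_comm _ _ _
      _ = 𝔼 u, 𝔼 v, 𝔼 s, 𝔼 t, f u * f v * (g (u + s) * g (v + s))
        * (h (u + t) * h (v + t)) := by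
          rw [expect_comm]
          exact expect_congr rfl fun u _ => expect_comm _ _ _
      _ = _ := by
          refine expect_congr rfl fun u _ => expect_congr rfl fun v _ => ?_
          simp_rw [← mul_expect, hR, ← expect_mul, ← mul_expect, hR]
  rw [h1]
  calc _ ≤ 𝔼 u : V, 𝔼 v : V, |autocorr g (u + v)| := by
        refine expect_mono fun u => expect_mono fun v => (le_abs_self _).trans ?_
        rw [abs_mul, abs_mul, abs_mul]
        have a1 : |f u| * |f v| ≤ 1 := mul_le_one₀ (hf _) (abs_nonneg _) (hf _)
        have a2 := abs_autocorr_le_one hh (u + v)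
        calc _ ≤ 1 * |autocorr g (u + v)| * 1 := by gcongr
          _ = _ := by ring
    _ = 𝔼 u : V, 𝔼 w, |autocorr g w| :=
        expect_congr rfl fun u _ => expect_shift_left (fun w => |autocorr g w|) u
    _ ≤ δ := expect_le_of_le fun _ => expect_abs_autocorr_le hδ hg hF

end BinaryFourier

/-! ### Counting squares in uniform sets -/

namespace BinaryFourier

lemma weight_mem_Icc {V : Type*} {f g h : V → ℝ} (hf : ∀ x, f x ∈ Set.Icc (0 : ℝ) 1)
    (hg : ∀ x, g x ∈ Set.Icc (0 : ℝ) 1) (hh : ∀ x, h x ∈ Set.Icc (0 : ℝ) 1) (x y z : V) :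
    f x * g y * h z ∈ Set.Icc (0 : ℝ) 1 :=
  ⟨mul_nonneg (mul_nonneg (hf x).1 (hg y).1) (hh z).1,
    mul_le_one₀ (mul_le_one₀ (hf x).2 (hg y).1 (hg y).2) (hh z).1 (hh z).2⟩

lemma add_add_cancel_right_self {V : Type*} [AddCommGroup V] [Module (ZMod 2) V] (x y : V) :
    x + y + y = x := by
  rw [add_assoc, add_self_eq_zero, add_zero]

section TriAvg

variable {V : Type*} [AddCommGroup V] [Fintype V]

/-- The average of `lam x y` over the pairs, weighted by `f x * g y * h (x + y)`. -/
noncomputable def triAvg (f g h : V → ℝ) (lam : V → V → ℝ) : ℝ :=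
  𝔼 x, 𝔼 y, f x * g y * h (x + y) * lam x y

lemma triAvg_abs_sub_le {f g h : V → ℝ} (hf : ∀ x, f x ∈ Set.Icc (0 : ℝ) 1)
    (hg : ∀ x, g x ∈ Set.Icc (0 : ℝ) 1) (hh : ∀ x, h x ∈ Set.Icc (0 : ℝ) 1) {D : V → V → ℝ}
    {c η : ℝ} (hη : 0 ≤ η) (hD : 𝔼 x, 𝔼 y, (D x y - c) ^ 2 ≤ η ^ 2) :
    triAvg f g h (fun x y => |D x y - c|) ≤ η := by
  have h1 : triAvg f g h (fun x y => |D x y - c|) ≤ 𝔼 x, 𝔼 y, |D x y - c| :=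
    expect_mono fun x => expect_mono fun y => mul_le_of_le_one_left (abs_nonneg _)
      (weight_mem_Icc hf hg hh _ _ _).2
  refine h1.trans (abs_le_of_sq_le_sq' ?_ hη).2
  refine (sq_expect_le _).trans (le_trans (expect_mono fun x => ?_) hD)
  simpa only [sq_abs] using sq_expect_le fun y => |D x y - c|

lemma triAvg_mono {f g h : V → ℝ} (hf : ∀ x, f x ∈ Set.Icc (0 : ℝ) 1)
    (hg : ∀ x, g x ∈ Set.Icc (0 : ℝ) 1) (hh : ∀ x, h x ∈ Set.Icc (0 : ℝ) 1) {M N : V → V → ℝ}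
    (hMN : ∀ x y, M x y ≤ N x y) : triAvg f g h M ≤ triAvg f g h N :=
  expect_mono fun x => expect_mono fun y =>
    mul_le_mul_of_nonneg_left (hMN x y) (weight_mem_Icc hf hg hh _ _ _).1

lemma triAvg_add (f g h : V → ℝ) (M N : V → V → ℝ) :
    triAvg f g h (fun x y => M x y + N x y) = triAvg f g h M + triAvg f g h N := by
  simp only [triAvg, mul_add, expect_add_distrib]

lemma triAvg_const_mul (f g h : V → ℝ) (c : ℝ) (M : V → V → ℝ) :
    triAvg f g h (fun x y => c * M x y) = c * triAvg f g h M := by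
  simp only [triAvg, mul_expect]
  refine expect_congr rfl fun x _ => expect_congr rfl fun y _ => ?_
  ring

lemma triAvg_nonneg {f g h : V → ℝ} (hf : ∀ x, f x ∈ Set.Icc (0 : ℝ) 1)
    (hg : ∀ x, g x ∈ Set.Icc (0 : ℝ) 1) (hh : ∀ x, h x ∈ Set.Icc (0 : ℝ) 1) {M : V → V → ℝ}
    (hM : ∀ x y, 0 ≤ M x y) : 0 ≤ triAvg f g h M :=
  le_expect_of_le fun x => le_expect_of_le fun y =>
    mul_nonneg (weight_mem_Icc hf hg hh _ _ _).1 (hM x y)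

lemma triAvg_one_le_one {f g h : V → ℝ} (hf : ∀ x, f x ∈ Set.Icc (0 : ℝ) 1)
    (hg : ∀ x, g x ∈ Set.Icc (0 : ℝ) 1) (hh : ∀ x, h x ∈ Set.Icc (0 : ℝ) 1) :
    triAvg f g h (fun _ _ => 1) ≤ 1 :=
  expect_le_of_le fun x => expect_le_of_le fun y => by
    rw [mul_one]; exact (weight_mem_Icc hf hg hh _ _ _).2

end TriAvg

variable {V : Type*} [AddCommGroup V] [Module (ZMod 2) V] [Fintype V]

lemma expect_add_snd {V : Type*} [AddCommGroup V] [Fintype V] (F : V → V → ℝ) :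
    𝔼 x, 𝔼 y, F (x + y) y = 𝔼 s, 𝔼 t, F s t := by
  rw [expect_comm, expect_comm (f := F)]
  exact expect_congr rfl fun y _ => expect_shift (fun x => F x y) y

lemma abs_le_one_of_mem {a : ℝ} (h : a ∈ Set.Icc (0 : ℝ) 1) : |a| ≤ 1 :=
  abs_le.2 ⟨by linarith [h.1], h.2⟩

lemma expect_mem_Icc {ι : Type*} [Fintype ι] [Nonempty ι] {f : ι → ℝ}
    (hf : ∀ x, f x ∈ Set.Icc (0 : ℝ) 1) :
    𝔼 x, f x ∈ Set.Icc (0 : ℝ) 1 :=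
  ⟨le_expect_of_le fun x => (hf x).1, expect_le_of_le fun x => (hf x).2⟩

/-- All Fourier coefficients of `f` at nontrivial characters are at most `δ` in absolute value. -/
def IsUniform (δ : ℝ) (f : V → ℝ) : Prop :=
  ∀ l : Module.Dual (ZMod 2) V, l ≠ 0 → |fourier f l| ≤ δ

lemma expect_sgn {l : Module.Dual (ZMod 2) V} (hl : l ≠ 0) : 𝔼 x, sgn (l x) = 0 := by
  obtain ⟨v, hv⟩ : ∃ v, l v ≠ 0 := by
    by_contra! h
    exact hl (LinearMap.ext h)
  have hv1 : l v = 1 := (zmod_two_cases _).resolve_left hv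
  have h := expect_shift (fun x => sgn (l x)) v
  simp only [map_add, sgn_add, hv1, sgn_one, mul_neg, mul_one, expect_neg_distrib] at h
  linarith

lemma abs_fourier_sub_expect_le {δ : ℝ} (hδ : 0 ≤ δ) {g : V → ℝ} (hg : IsUniform δ g)
    (l : Module.Dual (ZMod 2) V) : |fourier (fun x => g x - 𝔼 y, g y) l| ≤ δ := by
  have h1 : fourier (fun x => g x - 𝔼 y, g y) l
      = fourier g l - (𝔼 y, g y) * 𝔼 x, sgn (l x) := by
    simp only [fourier, sub_mul, expect_sub_distrib, mul_expect]
  by_cases hl : l = 0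
  · subst hl
    rw [h1]
    simpa [fourier] using hδ
  · rw [h1, expect_sgn hl, mul_zero, sub_zero]
    exact hg l hl

lemma abs_sub_expect_le {ι : Type*} [Fintype ι] [Nonempty ι] {g : ι → ℝ}
    (hg : ∀ x, g x ∈ Set.Icc (0 : ℝ) 1) (x : ι) :
    |g x - 𝔼 y, g y| ≤ 1 := by
  have h1 := hg x
  have h2 := expect_mem_Icc hg
  exact abs_le.2 ⟨by linarith [h1.1, h2.2], by linarith [h1.2, h2.1]⟩

/-- The correlations with two uniform functions concentrate around the product of the averages. -/
lemma expect_corr_sub_sq_le {f g h : V → ℝ} {δ : ℝ} (hδ : 0 ≤ δ) (hf : ∀ x, |f x| ≤ 1)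
    (hg : ∀ x, g x ∈ Set.Icc (0 : ℝ) 1) (hh : ∀ x, h x ∈ Set.Icc (0 : ℝ) 1)
    (hug : IsUniform δ g) (huh : IsUniform δ h) :
    𝔼 s, 𝔼 t, (corr f g h s t - (𝔼 x, f x) * (𝔼 x, g x) * 𝔼 x, h x) ^ 2 ≤ 4 * δ := by
  set G : V → ℝ := fun x => g x - 𝔼 y, g y with hG
  set H : V → ℝ := fun x => h x - 𝔼 y, h y with hH
  have hg1 := expect_mem_Icc hg
  have hh1 := expect_mem_Icc hh
  set a := 𝔼 x, g x
  set b := 𝔼 x, h x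
  have key : ∀ s t, corr f g h s t - (𝔼 x, f x) * a * b
      = corr f G h s t + a * corr f H (fun _ => 1) t s := by
    intro s t
    simp only [corr, mul_expect, expect_mul, ← expect_add_distrib, ← expect_sub_distrib]
    refine expect_congr rfl fun u _ => ?_
    simp only [hG, hH]
    ring
  calc _ ≤ 𝔼 s, 𝔼 t, (2 * corr f G h s t ^ 2 + 2 * corr f H (fun _ => 1) t s ^ 2) := by
        refine expect_mono fun s => expect_mono fun t => ?_
        rw [key]
        have ha : a ^ 2 ≤ 1 := by nlinarith [hg1.1, hg1.2]
        have : (a * corr f H (fun _ => 1) t s) ^ 2 ≤ 1 * corr f H (fun _ => 1) t s ^ 2 := by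
          rw [mul_pow]; gcongr
        nlinarith [sq_nonneg (corr f G h s t - a * corr f H (fun _ => 1) t s)]
    _ = 2 * (𝔼 s, 𝔼 t, corr f G h s t ^ 2) + 2 * 𝔼 t, 𝔼 s, corr f H (fun _ => 1) t s ^ 2 := by
        simp only [expect_add_distrib, mul_expect]
        congr 1
        rw [expect_comm]
    _ ≤ 2 * δ + 2 * δ := by
        have h1 := expect_corr_sq_le hδ hf (abs_sub_expect_le hg)
          (fun x => abs_le_one_of_mem (hh x)) (abs_fourier_sub_expect_le hδ hug)
        have h2 := expect_corr_sq_le (h := fun _ => 1) hδ hf (abs_sub_expect_le hh)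
          (fun x => by simp) (abs_fourier_sub_expect_le hδ huh)
        gcongr
    _ = 4 * δ := by ring

/-- For a pair `(x, y)`, the total weight of the sides `d` with `χ d = 1` of the squares
`(x, y), (x + d, y), (x, y + d), (x + d, y + d)`; the side `d` has weight
`f (x + d) * g (y + d) * h (x + y + d)`. The indicator of `χ d = 1` is written as
`(1 - sgn (χ d)) / 2`. -/
noncomputable def squareWeight (χ : Module.Dual (ZMod 2) V) (f g h : V → ℝ) (x y : V) : ℝ :=
  𝔼 d, (1 - sgn (χ d)) / 2 * (f (x + d) * g (y + d) * h (x + y + d))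

lemma squareWeight_eq (χ : Module.Dual (ZMod 2) V) (f g h : V → ℝ) (x y : V) :
    squareWeight χ f g h x y
      = (corr f g h (x + y) y - sgn (χ x) * corr (fun u => f u * sgn (χ u)) g h (x + y) y) / 2 := by
  rw [squareWeight, ← expect_shift_left _ x]
  simp only [corr, mul_expect, ← expect_sub_distrib, expect_div]
  refine expect_congr rfl fun u _ => ?_
  rw [add_add_cancel_self, show y + (x + u) = u + (x + y) by abel,
    show x + y + (x + u) = x + (x + (u + y)) by abel, add_add_cancel_self, map_add, sgn_add]
  ring

/-- For uniform functions the number of squares of odd side is nearly the same at every corner. -/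
lemma expect_squareWeight_sub_sq_le {χ : Module.Dual (ZMod 2) V} (hχ : χ ≠ 0) {f g h : V → ℝ}
    {δ : ℝ} (hδ : 0 ≤ δ) (hδ1 : δ ≤ 1) (hf : ∀ x, f x ∈ Set.Icc (0 : ℝ) 1)
    (hg : ∀ x, g x ∈ Set.Icc (0 : ℝ) 1) (hh : ∀ x, h x ∈ Set.Icc (0 : ℝ) 1)
    (huf : IsUniform δ f) (hug : IsUniform δ g) (huh : IsUniform δ h) :
    𝔼 x, 𝔼 y, (squareWeight χ f g h x y - (𝔼 x, f x) * (𝔼 x, g x) * (𝔼 x, h x) / 2) ^ 2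
      ≤ 7 * δ := by
  have hg1 := expect_mem_Icc hg
  have hh1 := expect_mem_Icc hh
  set F : V → ℝ := fun u => f u * sgn (χ u) with hF
  have hF1 : ∀ u, |F u| ≤ 1 := fun u => by
    rw [hF, abs_mul, abs_sgn, mul_one]; exact abs_le_one_of_mem (hf u)
  have hFχ : |𝔼 u, F u| ≤ δ := huf χ hχ
  have h1 := expect_corr_sub_sq_le hδ (fun x => abs_le_one_of_mem (hf x)) hg hh hug huh
  have h2 := expect_corr_sub_sq_le hδ hF1 hg hh hug huh
  rw [← expect_add_snd] at h1 h2
  set a := 𝔼 x, g x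
  set b := 𝔼 x, h x
  set m := 𝔼 x, f x
  set p := 𝔼 x, F x
  have hab : (p * a * b) ^ 2 ≤ δ := by
    have e1 : p ^ 2 ≤ δ ^ 2 := sq_le_sq' (abs_le.1 hFχ).1 (abs_le.1 hFχ).2
    have e2 : (a * b) ^ 2 ≤ 1 := by
      have : a * b ≤ 1 := mul_le_one₀ hg1.2 hh1.1 hh1.2
      have : 0 ≤ a * b := mul_nonneg hg1.1 hh1.1
      nlinarith
    calc (p * a * b) ^ 2 = p ^ 2 * (a * b) ^ 2 := by ring
      _ ≤ δ ^ 2 * 1 := by gcongr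
      _ ≤ δ := by nlinarith
  calc _ ≤ 𝔼 x, 𝔼 y, (3 / 4 * (corr f g h (x + y) y - m * a * b) ^ 2
          + 3 / 4 * (corr F g h (x + y) y - p * a * b) ^ 2 + 3 / 4 * δ) := by
        refine expect_mono fun x => expect_mono fun y => ?_
        rw [squareWeight_eq]
        set A := corr f g h (x + y) y
        set B := corr F g h (x + y) y
        have hs : sgn (χ x) ^ 2 = 1 := by rw [sq, sgn_mul_self]
        set σ := sgn (χ x)
        have e1 : (A - σ * B) / 2 - m * a * b / 2
            = ((A - m * a * b) - σ * (B - p * a * b) - σ * (p * a * b)) / 2 := by ring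
        have e2 : ∀ r s t : ℝ, ((r - s - t) / 2) ^ 2 ≤ 3 / 4 * r ^ 2 + 3 / 4 * s ^ 2
            + 3 / 4 * t ^ 2 := fun r s t => by
          nlinarith [sq_nonneg (r + s), sq_nonneg (r + t), sq_nonneg (s - t)]
        rw [e1]
        refine (e2 _ _ _).trans ?_
        rw [mul_pow, mul_pow, hs, one_mul, one_mul]
        linarith
    _ = 3 / 4 * (𝔼 x, 𝔼 y, (corr f g h (x + y) y - m * a * b) ^ 2)
          + 3 / 4 * (𝔼 x, 𝔼 y, (corr F g h (x + y) y - p * a * b) ^ 2) + 3 / 4 * δ := by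
        simp only [expect_add_distrib, mul_expect]
        simp
    _ ≤ 7 * δ := by linarith

/-- `lam` is a `[0, 1]`-valued function of pairs `(x, y)` whose sum over the four corners of every
square with side `d` in `{χ = 1}` is at least `1`. -/
structure HitsSquares (χ : Module.Dual (ZMod 2) V) (lam : V → V → ℝ) : Prop where
  mem_Icc : ∀ x y, lam x y ∈ Set.Icc (0 : ℝ) 1
  one_le : ∀ x y d, χ d = 1 → 1 ≤ lam x y + lam (x + d) y + lam x (y + d) + lam (x + d) (y + d)

/-- Every square is hit by `lam` in one of its corners, and by symmetry all four corners contribute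
equally. -/
lemma triAvg_squareWeight_le {χ : Module.Dual (ZMod 2) V} {f g h : V → ℝ} {lam : V → V → ℝ}
    (hf : ∀ x, f x ∈ Set.Icc (0 : ℝ) 1)
    (hg : ∀ x, g x ∈ Set.Icc (0 : ℝ) 1) (hh : ∀ x, h x ∈ Set.Icc (0 : ℝ) 1)
    (hlam : HitsSquares χ lam) :
    triAvg f g h (squareWeight χ f g h)
      ≤ 4 * triAvg f g h (fun x y => lam x y * squareWeight χ f g h x y) := by
  set K : V → V → V → ℝ := fun d x y =>
    (1 - sgn (χ d)) / 2 * (f x * g y * h (x + y)) * (f (x + d) * g (y + d) * h (x + y + d)) with hK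
  have hK0 : ∀ d x y, 0 ≤ K d x y := by
    intro d x y
    have : 0 ≤ (1 - sgn (χ d)) / 2 := by
      rcases zmod_two_cases (χ d) with h | h <;> simp [h]
    exact mul_nonneg (mul_nonneg this (weight_mem_Icc hf hg hh _ _ _).1)
      (weight_mem_Icc hf hg hh _ _ _).1
  have hsx : ∀ d x y, K d (x + d) y = K d x y := by
    intro d x y
    simp only [hK]
    rw [add_add_cancel_right_self, show x + d + y = x + y + d by abel, add_add_cancel_right_self]
    ring
  have hsy : ∀ d x y, K d x (y + d) = K d x y := by
    intro d x y
    simp only [hK]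
    rw [add_add_cancel_right_self, show x + (y + d) = x + y + d by abel, add_add_cancel_right_self]
    ring
  have hx : ∀ (M : V → V → ℝ) d, 𝔼 x, 𝔼 y, K d x y * M (x + d) y = 𝔼 x, 𝔼 y, K d x y * M x y := by
    intro M d
    rw [← expect_shift (fun x => 𝔼 y, K d x y * M x y) d]
    simp_rw [hsx]
  have hy : ∀ (M : V → V → ℝ) d, 𝔼 x, 𝔼 y, K d x y * M x (y + d) = 𝔼 x, 𝔼 y, K d x y * M x y := by
    intro M d
    refine expect_congr rfl fun x _ => ?_
    rw [← expect_shift (fun y => K d x y * M x y) d]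
    simp_rw [hsy]
  have hK' : ∀ M : V → V → ℝ, triAvg f g h (fun x y => M x y * squareWeight χ f g h x y)
      = 𝔼 d, 𝔼 x, 𝔼 y, K d x y * M x y := by
    intro M
    rw [expect_comm]
    refine expect_congr rfl fun x _ => ?_
    rw [expect_comm]
    refine expect_congr rfl fun y _ => ?_
    simp only [squareWeight, mul_expect]
    refine expect_congr rfl fun d _ => ?_
    simp only [hK]
    ring
  have h1 := hK' fun _ _ => 1
  simp only [one_mul, mul_one] at h1
  rw [h1, hK', mul_expect]
  refine expect_mono fun d => ?_
  calc 𝔼 x, 𝔼 y, K d x y ≤ 𝔼 x, 𝔼 y, (K d x y * lam x y + K d x y * lam (x + d) y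
        + K d x y * lam x (y + d) + K d x y * lam (x + d) (y + d)) := by
        refine expect_mono fun x => expect_mono fun y => ?_
        rcases zmod_two_cases (χ d) with h | h
        · simp [hK, h]
        · have := mul_le_mul_of_nonneg_left (hlam.one_le x y d h) (hK0 d x y)
          linarith
    _ = 4 * 𝔼 x, 𝔼 y, K d x y * lam x y := by
        simp only [expect_add_distrib]
        rw [hx, hy, hx (fun x y => lam x (y + d)), hy]
        ring

/-- On a space where the three functions are uniform, a function hitting all squares with side in
`{χ = 1}` captures a constant proportion of the weight. The value of `δ` makes the root mean square
`√(7 * δ)` of the deviation of `squareWeight` equal to `τ ^ 4 / 20`; this is small against the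
product of the weight, at least `τ`, with the typical value of `squareWeight`, at least
`τ ^ 3 / 2`. -/
theorem triAvg_ge_of_isUniform {χ : Module.Dual (ZMod 2) V} (hχ : χ ≠ 0) {f g h : V → ℝ}
    {lam : V → V → ℝ} {τ δ : ℝ} (hτ : 0 < τ) (hδ : δ = τ ^ 8 / 2800)
    (hf : ∀ x, f x ∈ Set.Icc (0 : ℝ) 1)
    (hg : ∀ x, g x ∈ Set.Icc (0 : ℝ) 1) (hh : ∀ x, h x ∈ Set.Icc (0 : ℝ) 1)
    (huf : IsUniform δ f) (hug : IsUniform δ g) (huh : IsUniform δ h) (hlam : HitsSquares χ lam)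
    (hw : τ ≤ triAvg f g h fun _ _ => 1) :
    triAvg f g h (fun _ _ => 1) / 8 ≤ triAvg f g h lam := by
  have hf1 := expect_mem_Icc hf
  have hg1 := expect_mem_Icc hg
  have hh1 := expect_mem_Icc hh
  set w := triAvg f g h fun _ _ => 1 with hwdef
  have hwf : w ≤ 𝔼 x, f x := by
    refine expect_mono fun x => expect_le_of_le fun y => ?_
    have := mul_le_mul_of_nonneg_left (mul_le_one₀ (hg y).2 (hh (x + y)).1 (hh (x + y)).2) (hf x).1
    linarith
  have hwg : w ≤ 𝔼 y, g y := by
    rw [hwdef, triAvg, expect_comm]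
    refine expect_mono fun y => expect_le_of_le fun x => ?_
    have := mul_le_mul_of_nonneg_left (mul_le_one₀ (hf x).2 (hh (x + y)).1 (hh (x + y)).2) (hg y).1
    linarith
  have hwh : w ≤ 𝔼 z, h z := by
    refine expect_le_of_le fun x => ?_
    rw [← expect_shift_left h x]
    refine expect_mono fun y => ?_
    have := mul_le_mul_of_nonneg_left (mul_le_one₀ (hf x).2 (hg y).1 (hg y).2) (hh (x + y)).1
    linarith
  have hw1 : w ≤ 1 := hwf.trans hf1.2
  have hτ1 : τ ^ 8 ≤ 1 := pow_le_one₀ hτ.le (hw.trans hw1)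
  have hδ0 : 0 ≤ δ := by rw [hδ]; positivity
  have hsq := expect_squareWeight_sub_sq_le hχ hδ0 (by rw [hδ]; linarith) hf hg hh huf hug huh
  set c := (𝔼 x, f x) * (𝔼 x, g x) * (𝔼 x, h x) / 2
  have hc : τ ^ 3 / 2 ≤ c := by
    have e1 : τ * τ * τ ≤ (𝔼 x, f x) * (𝔼 x, g x) * (𝔼 x, h x) := by
      have := hw.trans hwf
      have := hw.trans hwg
      have := hw.trans hwh
      gcongr
      · exact mul_nonneg hf1.1 hg1.1
      · exact hf1.1
    simp only [c]
    linarith [show τ ^ 3 = τ * τ * τ by ring]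
  have herr := triAvg_abs_sub_le hf hg hh (D := squareWeight χ f g h) (c := c)
    (η := τ ^ 4 / 20) (by positivity) (hsq.trans (by rw [hδ]; ring_nf; rfl))
  set D := squareWeight χ f g h
  have h1 : c * w - τ ^ 4 / 20 ≤ triAvg f g h D := by
    have e : c * w ≤ triAvg f g h D + triAvg f g h fun x y => |D x y - c| := by
      rw [hwdef, ← triAvg_const_mul, ← triAvg_add]
      refine triAvg_mono hf hg hh fun x y => ?_
      linarith [neg_abs_le (D x y - c)]
    linarith
  have h2 : triAvg f g h (fun x y => lam x y * D x y) ≤ c * triAvg f g h lam + τ ^ 4 / 20 := by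
    have e : triAvg f g h (fun x y => lam x y * D x y)
        ≤ c * triAvg f g h lam + triAvg f g h fun x y => |D x y - c| := by
      rw [← triAvg_const_mul, ← triAvg_add]
      refine triAvg_mono hf hg hh fun x y => ?_
      have l := hlam.mem_Icc x y
      have := mul_le_of_le_one_left (abs_nonneg (D x y - c)) l.2
      have := mul_le_mul_of_nonneg_left (le_abs_self (D x y - c)) l.1
      linarith
    linarith
  have h3 : triAvg f g h D ≤ 4 * triAvg f g h (fun x y => lam x y * D x y) :=
    triAvg_squareWeight_le hf hg hh hlam
  by_contra! hlt
  have h4 : c * (w - 4 * triAvg f g h lam) ≤ τ ^ 4 / 4 := by linarith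
  have h5 : τ / 2 < w - 4 * triAvg f g h lam := by linarith
  have h6 : τ ^ 3 / 2 * (τ / 2) < c * (w - 4 * triAvg f g h lam) :=
    mul_lt_mul' hc h5 (by positivity) (lt_of_lt_of_le (by positivity) hc)
  linarith [show τ ^ 3 / 2 * (τ / 2) = τ ^ 4 / 4 by ring]

end BinaryFourier

/-! ### Energy increment -/

namespace BinaryFourier

universe u

/-- The energy of a triple of functions: the sum of the squares of the three densities. -/
noncomputable def energy {V : Type u} [Fintype V] (f g h : V → ℝ) : ℝ :=
  (𝔼 x, f x) ^ 2 + (𝔼 x, g x) ^ 2 + (𝔼 x, h x) ^ 2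

lemma energy_le_three {V : Type u} [Fintype V] [Nonempty V] {f g h : V → ℝ}
    (hf : ∀ x, f x ∈ Set.Icc (0 : ℝ) 1)
    (hg : ∀ x, g x ∈ Set.Icc (0 : ℝ) 1) (hh : ∀ x, h x ∈ Set.Icc (0 : ℝ) 1) :
    energy f g h ≤ 3 := by
  have h1 := expect_mem_Icc hf
  have h2 := expect_mem_Icc hg
  have h3 := expect_mem_Icc hh
  have := pow_le_one₀ (n := 2) h1.1 h1.2
  have := pow_le_one₀ (n := 2) h2.1 h2.2
  have := pow_le_one₀ (n := 2) h3.1 h3.2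
  rw [energy]
  linarith

variable {V : Type u} [AddCommGroup V] [Module (ZMod 2) V]

/-- If `ℓ v = 1` then the space is the disjoint union of `ker ℓ` and `ker ℓ + v`. -/
lemma bijective_ker_add {l : Module.Dual (ZMod 2) V} {v : V} (hv : l v = 1) :
    Function.Bijective fun p : ZMod 2 × LinearMap.ker l => (p.2 : V) + p.1 • v := by
  constructor
  · rintro ⟨a, k⟩ ⟨b, k'⟩ h
    have hab : a = b := by
      have := congrArg l h
      simpa [hv] using this
    subst hab
    simpa using h
  · intro x
    refine ⟨(l x, ⟨x - l x • v, ?_⟩), ?_⟩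
    · simp [hv]
    · simp

variable [Fintype V]

lemma expect_ker {l : Module.Dual (ZMod 2) V} [Fintype (LinearMap.ker l)] {v : V} (hv : l v = 1)
    (F : V → ℝ) : 𝔼 x, F x = 𝔼 a : ZMod 2, 𝔼 k : LinearMap.ker l, F ((k : V) + a • v) := by
  rw [← Fintype.expect_bijective _ (bijective_ker_add hv) _ F fun _ => rfl]
  exact expect_product univ univ fun p : ZMod 2 × LinearMap.ker l => F ((p.2 : V) + p.1 • v)

lemma card_ker {l : Module.Dual (ZMod 2) V} [Fintype (LinearMap.ker l)] {v : V} (hv : l v = 1) :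
    Fintype.card V = 2 * Fintype.card (LinearMap.ker l) := by
  rw [← Fintype.card_of_bijective (bijective_ker_add hv), Fintype.card_prod, ZMod.card]

lemma expect_zmod_two (F : ZMod 2 → ℝ) : 𝔼 a, F a = (F 0 + F 1) / 2 := by
  rw [Fintype.expect_eq_sum_div_card, ZMod.card]
  congr 1
  exact Fin.sum_univ_two F

/-- Splitting along `ℓ` raises the mean square density by the square of the Fourier coefficient. -/
lemma expect_sq_expect_ker {l : Module.Dual (ZMod 2) V} [Fintype (LinearMap.ker l)] {v : V}
    (hv : l v = 1) (f : V → ℝ) :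
    𝔼 a : ZMod 2, (𝔼 k : LinearMap.ker l, f ((k : V) + a • v)) ^ 2
      = (𝔼 x, f x) ^ 2 + fourier f l ^ 2 := by
  rw [fourier, expect_ker hv f, expect_ker hv fun x => f x * sgn (l x)]
  have h : ∀ (a : ZMod 2) (k : LinearMap.ker l), l ((k : V) + a • v) = a := by
    intro a k
    simp [hv]
  simp only [h, ← expect_mul, expect_zmod_two, sgn_zero, sgn_one]
  ring

lemma triAvg_ker {l : Module.Dual (ZMod 2) V} [Fintype (LinearMap.ker l)] {v : V} (hv : l v = 1)
    (f g h : V → ℝ) (M : V → V → ℝ) :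
    triAvg f g h M = 𝔼 a : ZMod 2, 𝔼 b : ZMod 2,
      triAvg (fun k : LinearMap.ker l => f (k + a • v)) (fun k : LinearMap.ker l => g (k + b • v))
        (fun k : LinearMap.ker l => h (k + (a + b) • v)) (fun x y => M (x + a • v) (y + b • v)) := by
  rw [triAvg, expect_ker hv]
  refine expect_congr rfl fun a _ => ?_
  simp only [triAvg]
  rw [expect_comm (s := (univ : Finset (ZMod 2)))]
  refine expect_congr rfl fun k _ => ?_
  rw [expect_ker hv]
  refine expect_congr rfl fun b _ => expect_congr rfl fun k' _ => ?_
  rw [show (k : V) + a • v + (k' + b • v) = ((k + k' : LinearMap.ker l) : V) + (a + b) • v by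
    rw [add_smul, Submodule.coe_add]; abel]

lemma energy_ker {l : Module.Dual (ZMod 2) V} [Fintype (LinearMap.ker l)] {v : V} (hv : l v = 1)
    (f g h : V → ℝ) :
    𝔼 a : ZMod 2, 𝔼 b : ZMod 2, energy (fun k : LinearMap.ker l => f (k + a • v))
      (fun k : LinearMap.ker l => g (k + b • v)) (fun k : LinearMap.ker l => h (k + (a + b) • v))
      = energy f g h + (fourier f l ^ 2 + fourier g l ^ 2 + fourier h l ^ 2) := by
  simp only [energy, expect_add_distrib, Fintype.expect_const]
  rw [expect_sq_expect_ker hv, expect_sq_expect_ker hv]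
  have : ∀ a : ZMod 2, 𝔼 b : ZMod 2, (𝔼 k : LinearMap.ker l, h ((k : V) + (a + b) • v)) ^ 2
      = (𝔼 x, h x) ^ 2 + fourier h l ^ 2 := fun a => by
    rw [← expect_sq_expect_ker hv]
    exact expect_shift_left (fun b => (𝔼 k : LinearMap.ker l, h ((k : V) + b • v)) ^ 2) a
  simp only [this, Fintype.expect_const]
  ring

/-- A subspace of codimension at most `m` lies in at most `m` coordinate hyperplanes. -/
lemma card_coord_ne_zero {n m : ℕ} (φ : V →ₗ[ZMod 2] (Fin n → ZMod 2))
    (hφ : Function.Injective φ) (hm : 2 ^ n ≤ Fintype.card V * 2 ^ m) :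
    n ≤ #{i | LinearMap.proj i ∘ₗ φ ≠ 0} + m := by
  classical
  set S : Finset (Fin n) := {i | LinearMap.proj i ∘ₗ φ ≠ 0} with hS
  have hinj : Function.Injective fun (x : V) (i : S) => φ x i := by
    intro x y hxy
    apply hφ
    funext i
    by_cases hi : i ∈ S
    · exact congrFun hxy ⟨i, hi⟩
    · have h0 : LinearMap.proj i ∘ₗ φ = 0 := by simpa [hS] using hi
      exact (LinearMap.congr_fun h0 x).trans (LinearMap.congr_fun h0 y).symm
  have h1 := Fintype.card_le_of_injective _ hinj
  rw [Fintype.card_fun, ZMod.card, Fintype.card_coe] at h1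
  have h2 : 2 ^ n ≤ 2 ^ (#S + m) := by
    rw [pow_add]
    exact hm.trans (Nat.mul_le_mul_right _ h1)
  exact (Nat.pow_le_pow_iff_right (by norm_num)).1 h2

/-- The energy increment argument. On a space of small codimension `m`, embedded in `𝔽₂ⁿ` by `φ`,
with `t` further splittings allowed, the losses over all coordinates are large up to an error that
decreases with the energy and with `t`. A splitting raises the average energy by `δ ^ 2`, which pays
for the unit by which `t` drops; the error is at least `n`, and the bound trivial, when `t = 0`. -/
theorem sum_triAvg_ge {n T : ℕ} (hT : T ≤ n) {τ δ β : ℝ} (hτ : 0 < τ) (hδ : δ = τ ^ 8 / 2800)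
    (hβ : 0 ≤ β) (t : ℕ) (ht : t * (β * δ ^ 2) ≤ 1) :
    ∀ (V : Type u) [AddCommGroup V] [Module (ZMod 2) V] [Fintype V]
      (φ : V →ₗ[ZMod 2] (Fin n → ZMod 2)) (_ : Function.Injective φ) (m : ℕ)
      (_ : 2 ^ n ≤ Fintype.card V * 2 ^ m) (_ : m + t ≤ T) (f g h : V → ℝ)
      (_ : ∀ x, f x ∈ Set.Icc (0 : ℝ) 1) (_ : ∀ x, g x ∈ Set.Icc (0 : ℝ) 1)
      (_ : ∀ x, h x ∈ Set.Icc (0 : ℝ) 1) (lam : Fin n → V → V → ℝ)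
      (_ : ∀ i, HitsSquares (LinearMap.proj i ∘ₗ φ) (lam i)),
      ((n : ℝ) - T) / 8 * (triAvg f g h (fun _ _ => 1) - τ)
        - n * (β * (3 - energy f g h) + (1 - t * (β * δ ^ 2))) ≤ ∑ i, triAvg f g h (lam i) := by
  have hTn : (0 : ℝ) ≤ n - T := sub_nonneg.2 (by exact_mod_cast hT)
  have hT0 : (0 : ℝ) ≤ T := T.cast_nonneg
  induction t with
  | zero =>
    intro V _ _ _ φ hφ m hm hmt f g h hf hg hh lam hlam
    have h1 : 0 ≤ ∑ i, triAvg f g h (lam i) :=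
      sum_nonneg fun i _ => triAvg_nonneg hf hg hh fun x y => ((hlam i).mem_Icc x y).1
    have h2 := triAvg_one_le_one hf hg hh
    have h3 := mul_nonneg hβ (sub_nonneg.2 (energy_le_three hf hg hh))
    have h4 := mul_nonneg (n.cast_nonneg (α := ℝ)) h3
    have h5 : ((n : ℝ) - T) / 8 * (triAvg f g h (fun _ _ => 1) - τ) ≤ (n - T) / 8 * 1 := by
      gcongr
      linarith
    push_cast
    linarith
  | succ t ih =>
    intro V _ _ _ φ hφ m hm hmt f g h hf hg hh lam hlam
    have hδ2 : 0 ≤ β * δ ^ 2 := by positivity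
    push_cast at ht ⊢
    by_cases hu : IsUniform δ f ∧ IsUniform δ g ∧ IsUniform δ h
    · -- All three functions are uniform: every nonconstant coordinate has a loss.
      have h3 := mul_nonneg hβ (sub_nonneg.2 (energy_le_three hf hg hh))
      have h4 : 0 ≤ (n : ℝ) * (β * (3 - energy f g h) + (1 - (t + 1) * (β * δ ^ 2))) :=
        mul_nonneg n.cast_nonneg (add_nonneg h3 (by linarith))
      set w := triAvg f g h fun _ _ => 1 with hw
      have h0 : ∀ i, 0 ≤ triAvg f g h (lam i) := fun i =>
        triAvg_nonneg hf hg hh fun x y => ((hlam i).mem_Icc x y).1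
      rcases le_or_gt τ w with hτw | hτw
      · have h5 : ∀ i ∈ ({i | LinearMap.proj i ∘ₗ φ ≠ 0} : Finset (Fin n)),
            w / 8 ≤ triAvg f g h (lam i) := fun i hi =>
          triAvg_ge_of_isUniform (by simpa using hi) hτ hδ hf hg hh hu.1 hu.2.1 hu.2.2 (hlam i) hτw
        have h6 := card_nsmul_le_sum _ _ _ h5
        have h7 : ∑ i ∈ ({i | LinearMap.proj i ∘ₗ φ ≠ 0} : Finset (Fin n)), triAvg f g h (lam i)
            ≤ ∑ i, triAvg f g h (lam i) :=
          sum_le_sum_of_subset_of_nonneg (subset_univ _) fun i _ _ => h0 i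
        have h8 : (n : ℝ) - T ≤ #{i | LinearMap.proj i ∘ₗ φ ≠ 0} := by
          have := card_coord_ne_zero φ hφ hm
          have : n ≤ #{i | LinearMap.proj i ∘ₗ φ ≠ 0} + T := by omega
          have : (n : ℝ) ≤ #{i | LinearMap.proj i ∘ₗ φ ≠ 0} + T := by exact_mod_cast this
          linarith
        rw [nsmul_eq_mul] at h6
        have h9 : ((n : ℝ) - T) * (w / 8) ≤ #{i | LinearMap.proj i ∘ₗ φ ≠ 0} * (w / 8) :=
          mul_le_mul_of_nonneg_right h8 (by linarith)
        have h10 := mul_nonneg hTn hτ.le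
        linarith
      · have h5 : ((n : ℝ) - T) / 8 * (w - τ) ≤ 0 :=
          mul_nonpos_of_nonneg_of_nonpos (by linarith) (by linarith)
        have h6 : 0 ≤ ∑ i, triAvg f g h (lam i) := sum_nonneg fun i _ => h0 i
        linarith
    · -- Some function has a large Fourier coefficient: split along the corresponding hyperplane.
      obtain ⟨l, hl, hE⟩ : ∃ l : Module.Dual (ZMod 2) V, l ≠ 0 ∧
          δ ^ 2 ≤ fourier f l ^ 2 + fourier g l ^ 2 + fourier h l ^ 2 := by
        have hbig : ∀ {k : V → ℝ} {l}, δ < |fourier k l| → δ ^ 2 ≤ fourier k l ^ 2 := by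
          intro k l hk
          rw [← sq_abs (fourier k l)]
          have : 0 ≤ δ := by rw [hδ]; positivity
          gcongr
        have hneg : (∃ l : Module.Dual (ZMod 2) V, l ≠ 0 ∧ δ < |fourier f l|) ∨
            (∃ l : Module.Dual (ZMod 2) V, l ≠ 0 ∧ δ < |fourier g l|) ∨
            (∃ l : Module.Dual (ZMod 2) V, l ≠ 0 ∧ δ < |fourier h l|) := by
          by_contra! hcon
          exact hu ⟨hcon.1, hcon.2.1, hcon.2.2⟩
        rcases hneg with ⟨l, hl, hk⟩ | ⟨l, hl, hk⟩ | ⟨l, hl, hk⟩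
        · exact ⟨l, hl, by linarith [hbig hk, sq_nonneg (fourier g l), sq_nonneg (fourier h l)]⟩
        · exact ⟨l, hl, by linarith [hbig hk, sq_nonneg (fourier f l), sq_nonneg (fourier h l)]⟩
        · exact ⟨l, hl, by linarith [hbig hk, sq_nonneg (fourier f l), sq_nonneg (fourier g l)]⟩
      obtain ⟨v, hv0⟩ : ∃ v, l v ≠ 0 := by
        by_contra! h0
        exact hl (LinearMap.ext h0)
      have hv : l v = 1 := (zmod_two_cases _).resolve_left hv0
      let _ : Fintype (LinearMap.ker l) := Fintype.ofFinite _
      have hcard : 2 ^ n ≤ Fintype.card (LinearMap.ker l) * 2 ^ (m + 1) := by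
        rw [card_ker hv] at hm
        rw [pow_succ]
        linarith
      have hstep := fun a b : ZMod 2 => ih (by linarith) (LinearMap.ker l)
        (φ ∘ₗ (LinearMap.ker l).subtype) (hφ.comp Subtype.val_injective) (m + 1) hcard (by omega)
        (fun k => f (k + a • v)) (fun k => g (k + b • v)) (fun k => h (k + (a + b) • v))
        (fun _ => hf _) (fun _ => hg _) (fun _ => hh _)
        (fun i x y => lam i (x + a • v) (y + b • v))
        (fun i => ⟨fun _ _ => (hlam i).mem_Icc _ _, fun x y d hd => by
          have := (hlam i).one_le (x + a • v) (y + b • v) d hd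
          simpa only [Submodule.coe_add, add_right_comm] using this⟩)
      have havg := expect_mono fun a => expect_mono fun b => hstep a b
      have hw := triAvg_ker hv f g h (fun _ _ => 1)
      have hlams := fun i => triAvg_ker hv f g h (lam i)
      have hen := energy_ker hv f g h
      simp only [expect_sum_comm] at havg
      simp only [← hlams] at havg
      refine le_trans ?_ havg
      simp only [expect_sub_distrib, expect_add_distrib, ← mul_expect, Fintype.expect_const, ← hw,
        hen]
      have h1 : (n : ℝ) * (β * δ ^ 2)
          ≤ n * (β * (fourier f l ^ 2 + fourier g l ^ 2 + fourier h l ^ 2)) := by gcongr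
      linarith

/-- If the set of query triples has density at least a small negative power of `n`, then in some
coordinate a constant proportion of it is lost. -/
theorem exists_triAvg_ge : ∃ C : ℝ, 0 < C ∧ ∀ (n : ℕ) (α : ℝ), 0 < α → C ≤ n * α ^ 17 →
    ∀ f g h : (Fin n → ZMod 2) → ℝ, (∀ x, f x ∈ Set.Icc (0 : ℝ) 1) →
      (∀ x, g x ∈ Set.Icc (0 : ℝ) 1) → (∀ x, h x ∈ Set.Icc (0 : ℝ) 1) →
      ∀ lam : Fin n → (Fin n → ZMod 2) → (Fin n → ZMod 2) → ℝ,
      (∀ i, HitsSquares (LinearMap.proj i) (lam i)) → α ≤ triAvg f g h (fun _ _ => 1) →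
      ∃ i, triAvg f g h (fun _ _ => 1) / 16 ≤ triAvg f g h (lam i) := by
  refine ⟨8000 * (4 ^ 8 * 2800) ^ 2, by norm_num, ?_⟩
  intro n α hα hn f g h hf hg hh lam hlam hw
  set w := triAvg f g h fun _ _ => 1
  have hα1 : α ≤ 1 := hw.trans (triAvg_one_le_one hf hg hh)
  have hα17 : α ^ 17 ≤ 1 := pow_le_one₀ hα.le hα1
  have hn0 : (0 : ℝ) ≤ n := n.cast_nonneg
  have hn1 : 8000 * (4 ^ 8 * 2800) ^ 2 ≤ (n : ℝ) := hn.trans (mul_le_of_le_one_right hn0 hα17)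
  set δ := (α / 4) ^ 8 / 2800 with hδ
  have hδ0 : 0 < δ := by positivity
  -- Up to `T` splittings leave `3 n / 4` coordinates nonconstant. With `β = 1 / (T δ²)` the
  -- summand `1 - T β δ²` of the error vanishes, and `T` is large enough to make `β` small.
  set T := n / 4 with hT
  have hT4 : (T : ℝ) ≤ n / 4 := by
    have := Nat.cast_div_le (α := ℝ) (m := n) (n := 4)
    exact_mod_cast this
  have hT8 : (n : ℝ) / 8 ≤ T := by
    have h1 : n ≤ 4 * T + 3 := by omega
    have h2 : (n : ℝ) ≤ 4 * T + 3 := by exact_mod_cast h1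
    linarith
  have hT0 : (0 : ℝ) < T := by linarith
  have hβ : 1 / (T * δ ^ 2) ≤ α / 800 := by
    rw [div_le_div_iff₀ (by positivity) (by norm_num)]
    have h1 : α * (n / 8 * δ ^ 2) ≤ α * (T * δ ^ 2) := by gcongr
    have h2 : α * (n / 8 * δ ^ 2) = n * α ^ 17 / (8 * (4 ^ 8 * 2800) ^ 2) := by
      rw [hδ]; ring
    have h3 : (1000 : ℝ) ≤ n * α ^ 17 / (8 * (4 ^ 8 * 2800) ^ 2) := by
      rw [le_div_iff₀ (by norm_num)]
      linarith
    linarith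
  have key := sum_triAvg_ge (n := n) (T := T) (by omega) (τ := α / 4) (δ := δ)
    (β := 1 / (T * δ ^ 2)) (by positivity) hδ (by positivity) T (le_of_eq (by field_simp))
    (Fin n → ZMod 2) LinearMap.id Function.injective_id 0 (by simp [ZMod.card]) (by omega)
    f g h hf hg hh lam (fun i => by simpa using hlam i)
  have e1 : (T : ℝ) * (1 / (T * δ ^ 2) * δ ^ 2) = 1 := by field_simp
  rw [e1, sub_self, add_zero] at key
  have e2 : 1 / (T * δ ^ 2) * (3 - energy f g h) ≤ α / 800 * 3 := by
    have : 0 ≤ energy f g h := by rw [energy]; positivity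
    have h3 := energy_le_three hf hg hh
    gcongr
    · linarith
  by_contra! hcon
  have h1 : ∑ i, triAvg f g h (lam i) ≤ ∑ _i : Fin n, w / 16 :=
    sum_le_sum fun i _ => (hcon i).le
  rw [sum_const, card_univ, Fintype.card_fin, nsmul_eq_mul] at h1
  have h2 : (3 / 4 * n) / 8 * (3 / 4 * w) ≤ ((n : ℝ) - T) / 8 * (w - α / 4) := by
    gcongr
    all_goals linarith
  have h3 : (n : ℝ) * (1 / (T * δ ^ 2) * (3 - energy f g h)) ≤ n * (α / 800 * 3) := by gcongr
  have h4 : (n : ℝ) * α ≤ n * w := by gcongr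
  have h5 : 0 < (n : ℝ) * α := mul_pos (by linarith) hα
  linarith

end BinaryFourier

/-! ### Adaptive choice of coordinates, and losing corners of squares -/

namespace MultiplayerGame

open BinaryFourier

/-- Strategies gain little over a sequence of adaptively chosen coordinates. If the answers to
every coordinate, together with the queries, take at most `B` values and every large product event
loses a proportion `γ` in some coordinate, then refining by the labels of `k` such coordinates
bounds the probability of winning all of them. -/
lemma card_win_le {Ω κ ι V : Type*} {Q : κ → Type*} [Fintype Ω] [Fintype κ] [DecidableEq κ]
    [∀ i, Fintype (Q i)] (z : Ω → κ → V) (q : ∀ i, V → ι → Q i) (lose : (∀ i, Q i) → Prop)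
    {γ a B : ℝ} (hγ1 : γ ≤ 1) (ha : 0 ≤ a) (hB : 1 ≤ B)
    (hQ : (Fintype.card (∀ i, Q i) : ℝ) ≤ B)
    (hard : ∀ E : κ → Set V, a ≤ Nat.card {p // ∀ i, z p i ∈ E i} → ∃ j,
      γ * Nat.card {p // ∀ i, z p i ∈ E i}
        ≤ Nat.card {p // (∀ i, z p i ∈ E i) ∧ lose fun i => q i (z p i) j})
    (k : ℕ) : ∀ E : κ → Set V,
      (Nat.card {p // (∀ i, z p i ∈ E i) ∧ ∀ j, ¬ lose fun i => q i (z p i) j} : ℝ)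
        ≤ (1 - γ) ^ k * Nat.card {p // ∀ i, z p i ∈ E i} + B ^ k * a := by
  classical
  have hγ : 0 ≤ 1 - γ := by linarith
  simp only [Nat.card_eq_fintype_card, Fintype.card_subtype] at hard ⊢
  have hwin : ∀ E : κ → Set V,
      (#{p | (∀ i, z p i ∈ E i) ∧ ∀ j, ¬ lose fun i => q i (z p i) j} : ℝ)
        ≤ #{p | ∀ i, z p i ∈ E i} := fun E => by
    gcongr with p
    exact fun h => h.1
  induction k with
  | zero =>
    intro E
    have := hwin E
    simp only [pow_zero, one_mul]
    linarith
  | succ k ih =>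
    intro E
    rcases lt_or_ge (#{p | ∀ i, z p i ∈ E i} : ℝ) a with h | h
    · have h1 : a ≤ B ^ (k + 1) * a := le_mul_of_one_le_left ha (one_le_pow₀ hB)
      have h2 : 0 ≤ (1 - γ) ^ (k + 1) * (#{p | ∀ i, z p i ∈ E i} : ℝ) := by positivity
      linarith [hwin E]
    · obtain ⟨j, hj⟩ := hard E h
      -- The cells of the partition of the product event by the labels of the coordinate `j`.
      set cell : (∀ i, Q i) → κ → Set V := fun c i => {x | x ∈ E i ∧ q i x j = c i} with hcell
      set good : Finset (∀ i, Q i) := {c | ¬ lose c} with hgood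
      have hfib : ∀ (P : Ω → Prop) [DecidablePred P], (∀ p, P p → ¬ lose fun i => q i (z p i) j) →
          #{p | (∀ i, z p i ∈ E i) ∧ P p} = ∑ c ∈ good, #{p | (∀ i, z p i ∈ cell c i) ∧ P p} := by
        intro P _ hP
        rw [card_eq_sum_card_fiberwise (f := fun p i => q i (z p i) j) (t := good)]
        · refine sum_congr rfl fun c _ => congrArg card ?_
          ext p
          simp only [hcell, mem_filter, mem_univ, true_and, Set.mem_ofPred_eq, funext_iff, forall_and]
          tauto
        · intro p hp
          have hp' := (mem_filter.1 hp).2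
          simpa [hgood] using hP p hp'.2
      have h1 : (#{p | (∀ i, z p i ∈ E i) ∧ ∀ j, ¬ lose fun i => q i (z p i) j} : ℝ)
          ≤ ∑ c ∈ good, ((1 - γ) ^ k * #{p | ∀ i, z p i ∈ cell c i} + B ^ k * a) := by
        rw [hfib _ fun p hp => hp j]
        push_cast
        refine sum_le_sum fun c _ => ?_
        convert ih (cell c) <;> rfl
      have h2 : (∑ c ∈ good, (#{p | ∀ i, z p i ∈ cell c i} : ℝ))
          ≤ (1 - γ) * #{p | ∀ i, z p i ∈ E i} := by
        have e1 := hfib (fun p => ¬ lose fun i => q i (z p i) j) fun p hp => hp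
        have e2 : ∀ c ∈ good, #{p | (∀ i, z p i ∈ cell c i) ∧ ¬ lose fun i => q i (z p i) j}
            = #{p | ∀ i, z p i ∈ cell c i} := by
          intro c hc
          refine congrArg card (filter_congr fun p _ => and_iff_left_of_imp fun hp => ?_)
          have : (fun i => q i (z p i) j) = c := funext fun i => (hp i).2
          rw [this]
          simpa [hgood] using hc
        rw [sum_congr rfl e2] at e1
        have e3 := card_filter_add_card_filter_not (s := ({p | ∀ i, z p i ∈ E i} : Finset Ω))
          (fun p => lose fun i => q i (z p i) j)
        rw [filter_filter, filter_filter, e1] at e3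
        have e4 : (#{p | (∀ i, z p i ∈ E i) ∧ lose fun i => q i (z p i) j} : ℝ)
            + ∑ c ∈ good, (#{p | ∀ i, z p i ∈ cell c i} : ℝ) = #{p | ∀ i, z p i ∈ E i} := by
          exact_mod_cast e3
        linarith
      have h3 : (#good : ℝ) ≤ B := le_trans (by exact_mod_cast card_le_univ _) hQ
      rw [sum_add_distrib, ← mul_sum, sum_const, nsmul_eq_mul] at h1
      calc _ ≤ _ := h1
        _ ≤ (1 - γ) ^ k * ((1 - γ) * #{p | ∀ i, z p i ∈ E i}) + B * (B ^ k * a) := by gcongr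
        _ = _ := by ring

/-- The query triple determined by the queries to the first two players. -/
def triple {V : Type*} [Add V] (p : V × V) : Fin 3 → V := ![p.1, p.2, p.1 + p.2]

section Squares

variable {Y : Fin 3 → Type*} [∀ i, Fintype (Y i)] {W : (Fin 3 → ZMod 2) → (∀ i, Y i) → Prop}
  {n : ℕ}

/-- The strategy `F` of the repeated game loses the coordinate `j` on the query triple
determined by `p`. -/
def Loses (W : (Fin 3 → ZMod 2) → (∀ i, Y i) → Prop)
    (F : Strategy (fun _ : Fin 3 => Fin n → ZMod 2) fun i => Fin n → Y i) (j : Fin n)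
    (p : (Fin n → ZMod 2) × (Fin n → ZMod 2)) : Prop :=
  ¬ W (fun i => triple p i j) fun i => F i (triple p i) j

/-- A strategy winning on all admissible queries shows that the value is `1`. -/
lemma one_le_value_of_forall {f : Strategy (fun _ : Fin 3 => ZMod 2) Y}
    (hf : ∀ x, x 0 + x 1 + x 2 = 0 → W x fun i => f i (x i)) : 1 ≤ (ofGHZQueries W).value := by
  have h1 : (ofGHZQueries W).success f = 1 := by
    rw [← (ofGHZQueries W).query_sum]
    refine sum_congr rfl fun x _ => ?_
    by_cases hx : x 0 + x 1 + x 2 = 0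
    · exact if_pos (hf x hx)
    · have h0 : (ofGHZQueries W).query x = 0 := if_neg hx
      rw [h0]
      exact ite_self 0
  rw [← h1]
  exact le_ciSup (Set.finite_range _).bddAbove f

open Classical in
/-- If the game has value less than `1`, then in each coordinate `j` a square whose side is `1` at
`j` has a losing corner: otherwise the four corners yield a perfect strategy for one round. -/
lemma hitsSquares_loses (hW : (ofGHZQueries W).value < 1)
    (F : Strategy (fun _ : Fin 3 => Fin n → ZMod 2) fun i => Fin n → Y i) (j : Fin n) :
    HitsSquares (LinearMap.proj j : Module.Dual (ZMod 2) (Fin n → ZMod 2))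
      (fun x y => if Loses W F j (x, y) then 1 else 0) := by
  refine ⟨fun x y => ?_, fun x y d hd => ?_⟩
  · split_ifs <;> simp
  · by_contra! hcon
    have hwin : ∀ a b : ZMod 2, ¬ Loses W F j (x + a • d, y + b • d) := by
      intro a b hL
      have h0 : ∀ x y, (0 : ℝ) ≤ if Loses W F j (x, y) then 1 else 0 := fun x y => by
        split_ifs <;> simp
      have h1 := h0 x y
      have h2 := h0 (x + d) y
      have h3 := h0 x (y + d)
      have h4 := h0 (x + d) (y + d)
      rcases zmod_two_cases a with rfl | rfl <;> rcases zmod_two_cases b with rfl | rfl <;>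
        simp only [zero_smul, one_smul, add_zero] at hL <;> rw [if_pos hL] at hcon <;> linarith
    refine hW.not_ge (one_le_value_of_forall
      (f := fun i c => F i (triple (x, y) i + (c + triple (x, y) i j) • d) j) fun r hr => ?_)
    have hr2 : r 2 = r 0 + r 1 := by
      have := add_add_cancel_self (r 0 + r 1) (r 2)
      rw [hr, add_zero] at this
      exact this.symm
    have hpt : triple (x + (r 0 + x j) • d, y + (r 1 + y j) • d)
        = fun i => triple (x, y) i + (r i + triple (x, y) i j) • d := by
      funext i
      fin_cases i
      · rfl
      · rfl
      · change x + (r 0 + x j) • d + (y + (r 1 + y j) • d)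
          = x + y + (r 2 + (x j + y j)) • d
        rw [hr2]
        module
    have hrj : r = fun i => triple (x + (r 0 + x j) • d, y + (r 1 + y j) • d) i j := by
      funext i
      rw [hpt]
      have hdj : d j = 1 := hd
      simp only [Pi.add_apply, Pi.smul_apply, hdj, smul_eq_mul, mul_one]
      rw [add_comm (r i), add_add_cancel_self]
    have := not_not.1 (hwin (r 0 + x j) (r 1 + y j))
    rw [← hrj] at this
    have hF : (fun i => F i (triple (x, y) i + (r i + triple (x, y) i j) • d) j)
        = fun i => F i (triple (x + (r 0 + x j) • d, y + (r 1 + y j) • d) i) j :=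
      funext fun i => congrArg (fun v => F i v j) (congrFun hpt i).symm
    rw [hF]
    exact this

end Squares

end MultiplayerGame

/-! ### Parallel repetition for the GHZ query distribution -/

namespace MultiplayerGame

open BinaryFourier

section Repetition

variable {Y : Fin 3 → Type*} {W : (Fin 3 → ZMod 2) → (∀ i, Y i) → Prop}
  {n : ℕ}

open Classical in
lemma triAvg_indicator {V : Type*} [AddCommGroup V] [Fintype V] (E : Fin 3 → Set V)
    (P : V × V → Prop) :
    triAvg (fun x => if x ∈ E 0 then 1 else 0) (fun x => if x ∈ E 1 then 1 else 0)
      (fun x => if x ∈ E 2 then 1 else 0) (fun x y => if P (x, y) then 1 else 0)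
      = Nat.card {p : V × V // (∀ i, triple p i ∈ E i) ∧ P p} / (Fintype.card V : ℝ) ^ 2 := by
  have h1 : ∀ x y : V, (if x ∈ E 0 then (1 : ℝ) else 0) * (if y ∈ E 1 then 1 else 0)
      * (if x + y ∈ E 2 then 1 else 0) * (if P (x, y) then 1 else 0)
      = if (∀ i, triple (x, y) i ∈ E i) ∧ P (x, y) then 1 else 0 := by
    intro x y
    have e : (∀ i, triple (x, y) i ∈ E i) ↔ x ∈ E 0 ∧ y ∈ E 1 ∧ x + y ∈ E 2 := by
      simp [triple, Fin.forall_fin_succ]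
    simp only [e]
    split_ifs <;> simp_all
  simp only [triAvg, h1]
  have h2 := expect_product (univ : Finset V) (univ : Finset V)
    (fun p => if (∀ i, triple p i ∈ E i) ∧ P p then (1 : ℝ) else 0)
  rw [← h2, univ_product_univ, Fintype.expect_eq_sum_div_card, sum_boole, Fintype.card_prod,
    Nat.card_eq_fintype_card, Fintype.card_subtype]
  push_cast
  rw [sq]

/-- The queries are uniform over the pairs of queries to the first two players. -/
lemma success_repetition_le (F : Strategy (fun _ : Fin 3 => Fin n → ZMod 2) fun i => Fin n → Y i) :
    ((ofGHZQueries W).repetition n).success F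
      ≤ Nat.card {p // ∀ j, ¬ Loses W F j p} / (Fintype.card (Fin n → ZMod 2) : ℝ) ^ 2 := by
  classical
  have hq : ∀ x, ((ofGHZQueries W).repetition n).query x
      = if x 0 + x 1 + x 2 = 0 then ((1 : ℝ) / 4) ^ n else 0 := by
    intro x
    change ∏ j, (if x 0 j + x 1 j + x 2 j = 0 then (1 : ℝ) / 4 else 0) = _
    split_ifs with h
    · have h0 : ∀ j, x 0 j + x 1 j + x 2 j = 0 := fun j => congrFun h j
      simp [h0]
    · obtain ⟨j, hj⟩ := Function.ne_iff.1 h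
      exact prod_eq_zero (mem_univ j) (if_neg hj)
  have hwin : ((ofGHZQueries W).repetition n).success F
      = #{x : Fin 3 → Fin n → ZMod 2 | (∀ j, W (fun i => x i j) fun i => F i (x i) j)
          ∧ x 0 + x 1 + x 2 = 0} * ((1 : ℝ) / 4) ^ n := by
    rw [← nsmul_eq_mul, ← sum_const, sum_filter]
    refine sum_congr rfl fun x _ => ?_
    rw [hq, ite_and]
    congr
  have htr : ∀ x : Fin 3 → Fin n → ZMod 2, x 0 + x 1 + x 2 = 0 → triple (x 0, x 1) = x := by
    intro x hx
    funext i
    fin_cases i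
    · rfl
    · rfl
    · have := add_add_cancel_self (x 0 + x 1) (x 2)
      rw [hx, add_zero] at this
      exact this
  have hcard : #{x : Fin 3 → Fin n → ZMod 2 | (∀ j, W (fun i => x i j) fun i => F i (x i) j)
      ∧ x 0 + x 1 + x 2 = 0} ≤ Nat.card {p // ∀ j, ¬ Loses W F j p} := by
    rw [Nat.card_eq_fintype_card, Fintype.card_subtype]
    refine card_le_card_of_injOn (fun x => (x 0, x 1)) ?_ ?_
    · intro x hx
      obtain ⟨hx1, hx2⟩ := (mem_filter.1 hx).2
      refine mem_coe.2 (mem_filter.2 ⟨mem_univ _, fun j => not_not.2 ?_⟩)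
      have := hx1 j
      rw [← htr x hx2] at this
      exact this
    · intro x hx y hy hxy
      have hx2 := (mem_filter.1 hx).2.2
      have hy2 := (mem_filter.1 hy).2.2
      rw [← htr x hx2, ← htr y hy2]
      exact congrArg triple hxy
  have h4 : ((1 : ℝ) / 4) ^ n = 1 / (Fintype.card (Fin n → ZMod 2) : ℝ) ^ 2 := by
    rw [Fintype.card_fun, ZMod.card, Fintype.card_fin]
    push_cast
    rw [← pow_mul, mul_comm n, pow_mul, one_div_pow]
    norm_num
  rw [hwin, h4, mul_one_div]
  gcongr

variable [∀ i, Fintype (Y i)]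

/-- Playing one coordinate bounds the value by `3 / 4`, as the losing pairs meet every square. -/
lemma success_repetition_le_three_quarters (hW : (ofGHZQueries W).value < 1) (hn : 1 ≤ n)
    (F : Strategy (fun _ : Fin 3 => Fin n → ZMod 2) fun i => Fin n → Y i) :
    ((ofGHZQueries W).repetition n).success F ≤ 3 / 4 := by
  classical
  set j : Fin n := ⟨0, hn⟩
  set lam : (Fin n → ZMod 2) → (Fin n → ZMod 2) → ℝ :=
    fun x y => if Loses W F j (x, y) then 1 else 0 with hlam
  have hsq := (hitsSquares_loses hW F j).one_le
  have h1 : 1 ≤ 4 * 𝔼 x, 𝔼 y, lam x y := by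
    set d : Fin n → ZMod 2 := Pi.single j 1
    have h2 : (1 : ℝ) ≤ 𝔼 x, 𝔼 y, (lam x y + lam (x + d) y + lam x (y + d)
        + lam (x + d) (y + d)) :=
      le_expect_of_le fun x => le_expect_of_le fun y => hsq x y d (by simp [d])
    simp only [expect_add_distrib, expect_shift (lam _) d] at h2
    rw [expect_shift (fun x => 𝔼 y, lam x y) d] at h2
    linarith
  have h3 := triAvg_indicator (fun _ : Fin 3 => (Set.univ : Set (Fin n → ZMod 2))) (Loses W F j)
  simp only [Set.mem_univ, if_true, implies_true, true_and, triAvg, one_mul] at h3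
  have h4 : Nat.card {p // Loses W F j p} + Nat.card {p // ¬ Loses W F j p}
      = Fintype.card (Fin n → ZMod 2) ^ 2 := by
    simp only [Nat.card_eq_fintype_card, Fintype.card_subtype]
    rw [card_filter_add_card_filter_not, card_univ, Fintype.card_prod, sq]
  have h5 : Nat.card {p // ∀ j, ¬ Loses W F j p} ≤ Nat.card {p // ¬ Loses W F j p} := by
    simp only [Nat.card_eq_fintype_card, Fintype.card_subtype]
    exact card_le_card (monotone_filter_right _ fun p _ hp => hp j)
  have h6 : (Nat.card {p // Loses W F j p} : ℝ) + Nat.card {p // ∀ j, ¬ Loses W F j p}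
      ≤ (Fintype.card (Fin n → ZMod 2) : ℝ) ^ 2 := by
    exact_mod_cast (Nat.add_le_add_left h5 _).trans h4.le
  have hN : (0 : ℝ) < (Fintype.card (Fin n → ZMod 2) : ℝ) ^ 2 := by
    have : 0 < Fintype.card (Fin n → ZMod 2) := Fintype.card_pos
    positivity
  have h7 : (1 : ℝ) ≤ 4 * (Nat.card {p // Loses W F j p}
      / (Fintype.card (Fin n → ZMod 2) : ℝ) ^ 2) := by
    rw [← h3]; exact h1
  refine (success_repetition_le F).trans ?_
  rw [← mul_div_assoc, le_div_iff₀ hN] at h7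
  rw [div_le_iff₀ hN]
  linarith

/-- The main estimate before optimizing the number `k` of coordinates and the density `α`. -/
lemma success_repetition_le_pow {C : ℝ}
    (hC : ∀ (n : ℕ) (α : ℝ), 0 < α → C ≤ n * α ^ 17 →
      ∀ f g h : (Fin n → ZMod 2) → ℝ, (∀ x, f x ∈ Set.Icc (0 : ℝ) 1) →
      (∀ x, g x ∈ Set.Icc (0 : ℝ) 1) → (∀ x, h x ∈ Set.Icc (0 : ℝ) 1) →
      ∀ lam : Fin n → (Fin n → ZMod 2) → (Fin n → ZMod 2) → ℝ,
      (∀ i, HitsSquares (LinearMap.proj i) (lam i)) → α ≤ triAvg f g h (fun _ _ => 1) →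
      ∃ i, triAvg f g h (fun _ _ => 1) / 16 ≤ triAvg f g h (lam i))
    {K : ℕ} (hY : ∀ i, Fintype.card (Y i) ≤ K) (hW : (ofGHZQueries W).value < 1)
    (F : Strategy (fun _ : Fin 3 => Fin n → ZMod 2) fun i => Fin n → Y i) (k : ℕ) {α : ℝ}
    (hα : 0 < α) (hn : C ≤ n * α ^ 17) :
    ((ofGHZQueries W).repetition n).success F
      ≤ (15 / 16) ^ k + ((2 * K) ^ 3 + 2 : ℕ) ^ k * α := by
  classical
  set N : ℝ := (Fintype.card (Fin n → ZMod 2) : ℝ) ^ 2 with hN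
  have hN0 : 0 < N := by
    have : 0 < Fintype.card (Fin n → ZMod 2) := Fintype.card_pos
    positivity
  have hQ : (Fintype.card (∀ i, ZMod 2 × Y i) : ℝ) ≤ ((2 * K) ^ 3 + 2 : ℕ) := by
    rw [Fintype.card_pi]
    have h1 : ∏ i, Fintype.card (ZMod 2 × Y i) ≤ ∏ _i : Fin 3, 2 * K :=
      prod_le_prod' fun i _ => by
        rw [Fintype.card_prod, ZMod.card]
        exact Nat.mul_le_mul_left _ (hY i)
    rw [prod_const, card_univ, Fintype.card_fin] at h1
    exact_mod_cast h1.trans (Nat.le_add_right _ _)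
  have hInd : ∀ (S : Set (Fin n → ZMod 2)) x, (if x ∈ S then (1 : ℝ) else 0) ∈ Set.Icc (0 : ℝ) 1 :=
    fun S x => by split_ifs <;> simp
  have key := card_win_le (Ω := (Fin n → ZMod 2) × (Fin n → ZMod 2)) (ι := Fin n)
    (Q := fun i => ZMod 2 × Y i) triple (fun i x j => (x j, F i x j))
    (fun c => ¬ W (fun i => (c i).1) fun i => (c i).2) (γ := 1 / 16) (a := α * N)
    (B := ((2 * K) ^ 3 + 2 : ℕ)) (by norm_num) (by positivity)
    (by exact_mod_cast (by omega : 1 ≤ (2 * K) ^ 3 + 2)) hQ ?_ k (fun _ => Set.univ)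
  · refine (success_repetition_le F).trans ?_
    rw [div_le_iff₀ hN0]
    simp only [Set.mem_univ, implies_true, true_and] at key
    have hall : (Nat.card {_p : (Fin n → ZMod 2) × (Fin n → ZMod 2) // True} : ℝ) = N := by
      rw [Nat.card_eq_fintype_card, Fintype.card_subtype_true, Fintype.card_prod, hN, sq]
      push_cast
      rfl
    rw [hall] at key
    refine (le_of_eq ?_).trans (key.trans (le_of_eq ?_))
    · rfl
    · norm_num
      ring
  · intro E hE
    have hT := triAvg_indicator E fun _ => True
    simp only [if_true, and_true] at hT
    obtain ⟨j, hj⟩ := hC n α hα hn _ _ _ (hInd (E 0)) (hInd (E 1)) (hInd (E 2))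
      (fun j x y => if Loses W F j (x, y) then 1 else 0) (hitsSquares_loses hW F)
      (by rw [hT, le_div_iff₀ hN0]; exact hE)
    refine ⟨j, ?_⟩
    rw [hT, triAvg_indicator E (Loses W F j), div_div, mul_comm, ← div_div,
      div_le_div_iff_of_pos_right hN0] at hj
    rw [one_div_mul_eq_div]
    exact hj

end Repetition

/-- Choosing `k` of order `log n` and `α` a small power of `1 / n` turns the estimate
`(15 / 16) ^ k + B ^ k * α` into a power of `n`; the bound `3 / 4` absorbs the constant factor. -/
lemma exists_rpow_bound {C : ℝ} (hC : 0 < C) {B : ℕ} (hB : 2 ≤ B) :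
    ∃ c : ℝ, 0 < c ∧ ∀ n : ℕ, 1 ≤ n → ∀ v : ℝ, v ≤ 3 / 4 →
      (∀ (k : ℕ) (α : ℝ), 0 < α → C ≤ n * α ^ 17 → v ≤ (15 / 16) ^ k + (B : ℝ) ^ k * α) →
      v ≤ (n : ℝ) ^ (-c) := by
  have hB1 : (1 : ℝ) < B := by exact_mod_cast hB
  have hb : 1 < B ^ 34 := Nat.one_lt_pow (by norm_num) hB
  have hlogb : 0 < Real.log ((B : ℝ) ^ 34) := Real.log_pos (one_lt_pow₀ hB1 (by norm_num))
  have hlog : 0 < Real.log (16 / 15) := Real.log_pos (by norm_num)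
  set η := Real.log (16 / 15) / Real.log ((B : ℝ) ^ 34) with hη
  have hη0 : 0 < η := div_pos hlog hlogb
  set c₁ := min η (1 / 34) with hc₁
  have hc₁0 : 0 < c₁ := lt_min hη0 (by norm_num)
  set D := 16 / 15 + C ^ (1 / 17 : ℝ) with hD
  have hCr : 0 < C ^ (1 / 17 : ℝ) := Real.rpow_pos_of_pos hC _
  have hD1 : 1 < D := by rw [hD]; linarith
  have hbound : ∀ n : ℕ, 1 ≤ n → ∀ v : ℝ,
      (∀ (k : ℕ) (α : ℝ), 0 < α → C ≤ n * α ^ 17 → v ≤ (15 / 16) ^ k + (B : ℝ) ^ k * α) →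
      v ≤ D * (n : ℝ) ^ (-c₁) := by
    intro n hn v hv
    have hn1 : (1 : ℝ) ≤ n := by exact_mod_cast hn
    have hn0 : (0 : ℝ) < n := by linarith
    set k := Nat.log (B ^ 34) n with hk
    have h1 : (B : ℝ) ^ k ≤ (n : ℝ) ^ (1 / 34 : ℝ) := by
      have e : (B ^ k) ^ 34 ≤ n := by
        rw [← pow_mul, mul_comm, pow_mul]
        exact Nat.pow_log_le_self _ (by omega)
      have e' : ((B : ℝ) ^ k) ^ 34 ≤ n := by exact_mod_cast e
      calc (B : ℝ) ^ k = (((B : ℝ) ^ k) ^ 34) ^ (1 / 34 : ℝ) := by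
            rw [← Real.rpow_natCast ((B : ℝ) ^ k) 34, ← Real.rpow_mul (by positivity)]
            norm_num
        _ ≤ _ := by gcongr
    have h2 : ((15 : ℝ) / 16) ^ k ≤ 16 / 15 * (n : ℝ) ^ (-η) := by
      have e : n < (B ^ 34) ^ (k + 1) := Nat.lt_pow_succ_log_self hb n
      have e' : (n : ℝ) ≤ ((B : ℝ) ^ 34) ^ (k + 1) := by exact_mod_cast e.le
      have e2 : Real.log n ≤ (k + 1) * Real.log ((B : ℝ) ^ 34) := by
        have := Real.log_le_log hn0 e'
        rw [Real.log_pow] at this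
        exact_mod_cast this
      have e3 : η * Real.log n ≤ (k + 1) * Real.log (16 / 15) := by
        rw [hη, div_mul_eq_mul_div, div_le_iff₀ hlogb]
        calc _ ≤ Real.log (16 / 15) * ((k + 1) * Real.log ((B : ℝ) ^ 34)) := by gcongr
          _ = _ := by ring
      have e4 : ((15 : ℝ) / 16) ^ (k + 1) ≤ (n : ℝ) ^ (-η) := by
        rw [Real.rpow_def_of_pos hn0, ← Real.log_le_iff_le_exp (by positivity), Real.log_pow,
          show (15 : ℝ) / 16 = (16 / 15)⁻¹ by norm_num, Real.log_inv]
        push_cast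
        linarith
      rw [pow_succ] at e4
      linarith
    have h3 := hv k ((C / n) ^ (1 / 17 : ℝ)) (by positivity) (by
      rw [← Real.rpow_natCast, ← Real.rpow_mul (by positivity)]
      norm_num
      rw [mul_div_cancel₀ _ hn0.ne'])
    have h4 : (B : ℝ) ^ k * (C / n) ^ (1 / 17 : ℝ) ≤ C ^ (1 / 17 : ℝ) * (n : ℝ) ^ (-(1 / 34) : ℝ) := by
      rw [Real.div_rpow hC.le hn0.le]
      calc _ ≤ (n : ℝ) ^ (1 / 34 : ℝ) * (C ^ (1 / 17 : ℝ) / (n : ℝ) ^ (1 / 17 : ℝ)) := by gcongr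
        _ = C ^ (1 / 17 : ℝ) * ((n : ℝ) ^ (1 / 34 : ℝ) / (n : ℝ) ^ (1 / 17 : ℝ)) := by ring
        _ = _ := by
          rw [← Real.rpow_sub hn0]
          norm_num
    have h5 : (n : ℝ) ^ (-η) ≤ (n : ℝ) ^ (-c₁) :=
      Real.rpow_le_rpow_of_exponent_le hn1 (neg_le_neg (min_le_left _ _))
    have h6 : (n : ℝ) ^ (-(1 / 34) : ℝ) ≤ (n : ℝ) ^ (-c₁) :=
      Real.rpow_le_rpow_of_exponent_le hn1 (neg_le_neg (min_le_right _ _))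
    calc v ≤ _ := h3
      _ ≤ 16 / 15 * (n : ℝ) ^ (-c₁) + C ^ (1 / 17 : ℝ) * (n : ℝ) ^ (-c₁) :=
        add_le_add (h2.trans (by gcongr)) (h4.trans (by gcongr))
      _ = D * (n : ℝ) ^ (-c₁) := by rw [hD]; ring
  -- A weighted geometric mean of the two bounds `3 / 4` and `D * n ^ (-c₁)`, with the weights
  -- chosen such that the constants cancel.
  have ha : 0 < Real.log (4 / 3) := Real.log_pos (by norm_num)
  have hd : 0 < Real.log D := Real.log_pos hD1
  refine ⟨Real.log (4 / 3) * c₁ / (Real.log (4 / 3) + Real.log D), by positivity, ?_⟩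
  intro n hn v hv1 hv2
  have hn0 : (0 : ℝ) < n := by exact_mod_cast hn
  rcases le_or_gt v 0 with hv0 | hv0
  · exact hv0.trans (by positivity)
  rw [Real.rpow_def_of_pos hn0, ← Real.log_le_iff_le_exp hv0]
  have h1 : Real.log v ≤ -Real.log (4 / 3) := by
    rw [← Real.log_inv]
    exact Real.log_le_log hv0 (by norm_num; exact hv1)
  have h2 : Real.log v ≤ Real.log D - c₁ * Real.log n := by
    have := Real.log_le_log hv0 (hbound n hn v hv2)
    rw [Real.log_mul (by linarith) (by positivity), Real.log_rpow hn0] at this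
    linarith
  rw [mul_neg, ← mul_div_assoc, ← neg_div, le_div_iff₀ (by positivity)]
  have h3 := mul_le_mul_of_nonneg_left h1 hd.le
  have h4 := mul_le_mul_of_nonneg_left h2 ha.le
  linarith

/-- Parallel repetition for all games with the GHZ query distribution. -/
theorem exists_value_repetition_le (K : ℕ) : ∃ c : ℝ, 0 < c ∧
    ∀ (Y : Fin 3 → Type*) [∀ i, Fintype (Y i)], (∀ i, Fintype.card (Y i) ≤ K) →
    ∀ W : (Fin 3 → ZMod 2) → (∀ i, Y i) → Prop, (ofGHZQueries W).value < 1 →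
    ∀ n : ℕ, 1 ≤ n → ((ofGHZQueries W).repetition n).value ≤ (n : ℝ) ^ (-c) := by
  obtain ⟨C, hC0, hC⟩ := exists_triAvg_ge
  obtain ⟨c, hc, h⟩ := exists_rpow_bound hC0 (B := (2 * K) ^ 3 + 2) (by omega)
  refine ⟨c, hc, fun Y _ hY W hW n hn => ?_⟩
  -- If some answer set is empty then the supremum is over the empty set, and the value is `0`.
  refine Real.iSup_le (fun F => ?_) (by positivity)
  exact h n hn _ (success_repetition_le_three_quarters hW hn F)
    fun k α hα hα' => success_repetition_le_pow hC hY hW F k hα hα'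

/-- The four winning conditions of the GHZ game cannot hold together, as they sum to `0 = 1`; here
this is checked over all strategies. -/
lemma value_GHZ_lt_one : GHZ.value < 1 := by
  obtain ⟨f, hf⟩ := (isGreatest_value GHZ).1
  rw [← hf, ← GHZ.query_sum]
  have hdec : ∀ a b c : ZMod 2 → ZMod 2, ∃ x : Fin 3 → ZMod 2, x 0 + x 1 + x 2 = 0 ∧
      ¬ (a (x 0) + b (x 1) + c (x 2) = 1 ↔ (x 0 = 1 ∨ x 1 = 1 ∨ x 2 = 1)) := by
    decide
  obtain ⟨x, hx, hlose⟩ := hdec (f 0) (f 1) (f 2)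
  refine sum_lt_sum (fun y _ => ?_) ⟨x, mem_univ _, ?_⟩
  · split_ifs
    · exact le_rfl
    · exact GHZ.query_nonneg y
  · have hl : ¬ GHZ.W x fun i => f i (x i) := hlose
    rw [if_neg hl]
    have : GHZ.query x = 1 / 4 := if_pos hx
    rw [this]
    norm_num

end MultiplayerGame

theorem theorem1p1 :
    (∃ c : ℝ, 0 < c ∧ ∀ n : ℕ, 1 ≤ n →
      (MultiplayerGame.GHZ.repetition n).value ≤ (n : ℝ) ^ (-c)) ∧
    (∀ K : ℕ, ∃ c : ℝ, 0 < c ∧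
      ∀ (Y : Fin 3 → Type*) [∀ i, Fintype (Y i)], (∀ i, Fintype.card (Y i) ≤ K) →
      ∀ W : (Fin 3 → ZMod 2) → (∀ i, Y i) → Prop,
      (MultiplayerGame.ofGHZQueries W).value < 1 →
      ∀ n : ℕ, 1 ≤ n →
        ((MultiplayerGame.ofGHZQueries W).repetition n).value ≤ (n : ℝ) ^ (-c)) := by
  refine ⟨?_, MultiplayerGame.exists_value_repetition_le⟩
  obtain ⟨c, hc, h⟩ := MultiplayerGame.exists_value_repetition_le 2
  exact ⟨c, hc, h (fun _ => ZMod 2) (fun _ => le_of_eq (ZMod.card 2)) _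
    MultiplayerGame.value_GHZ_lt_one⟩
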